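/- Let $K$ be a field and let $E=(E^0,E^1,r,s)$ be an arbitrary directed graph (no restriction on the number of vertices, of edges, or of edges emitted by a vertex). Let $L=L_K(E)$ be the Leavitt path algebra of $E$ over $K$: the associative, not necessarily unital $K$-algebra generated by pairwise orthogonal idempotents $v\in E^0$ and elements $e,e^*$ ($e\in E^1$) subject to $s(e)e=e=er(e)$, $r(e)e^*=e^*=e^*s(e)$, $e^*e=r(e)$, $e^*f=0$ for $e\neq f$, and $v=\sum_{s(e)=v}ee^*$ for every vertex $v$ that emits a non-empty finite set of edges. An ideal (always two-sided) $P$ of a ring $R$ is prime if $P\ne R$ and $IJ\subseteq P$ implies $I\subseteq P$ or $J\subseteq P$ for all ideals $I,J$ of $R$. A prime ideal $P$ of $R$ is locally closed if $P$ is not the intersection of all the prime ideals of $R$ properly containing $P$ (the empty intersection being $R$). For a prime $K$-algebra $A$, the Martindale ring of quotients of $A$ consists of the classes of pairs $(I,f)$, where $I$ is a nonzero ideal of $A$ and $f\colon I\to A$ is a homomorphism of right $A$-modules, two pairs being equivalent if the maps agree on the intersection of their domains; addition is $(I,f)+(J,g)=(I\cap J,f+g)$ and multiplication is $(I,f)(J,g)=(JI,f\circ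 g)$. The extended centroid $C(A)$ of $A$ is the center of this ring; it contains $K$ through $k\mapsto[(A,a\mapsto ka)]$. If $P$ is a locally closed prime ideal of $L$, then $P$ is rational, i.e. the extended centroid $C(L/P)$ of $L/P$ is algebraic over $K$. -/

import Mathlib

universe u v w

/-! ### Scalars on quotients by ring congruences -/

namespace RingCon

variable {K : Type u} [CommSemiring K] {A : Type v} [NonUnitalRing A] [Module K A]

/-- The `K`-module structure on the quotient of a (not necessarily unital) `K`-algebra by a
congruence that is compatible with the action of `K`. -/
@[reducible]
def quotientModule (c : RingCon A) (h : ∀ (k : K) (x y : A), c x y → c (k • x) (k • y)) :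
    Module K c.Quotient where
  smul := c.smulAux h
  one_smul := Quotient.ind' fun _ => congr_arg toQuotient (one_smul K _)
  mul_smul _ _ := Quotient.ind' fun _ => congr_arg toQuotient (mul_smul _ _ _)
  smul_zero _ := congr_arg toQuotient (smul_zero _)
  smul_add _ := Quotient.ind₂' fun _ _ => congr_arg toQuotient (smul_add _ _ _)
  add_smul _ _ := Quotient.ind' fun _ => congr_arg toQuotient (add_smul _ _ _)
  zero_smul := Quotient.ind' fun _ => congr_arg toQuotient (zero_smul K _)

theorem quotientModule_isScalarTower [IsScalarTower K A A] (c : RingCon A)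
    (h : ∀ (k : K) (x y : A), c x y → c (k • x) (k • y)) :
    letI := quotientModule c h
    IsScalarTower K c.Quotient c.Quotient :=
  letI := quotientModule c h
  ⟨fun _ => Quotient.ind₂' fun _ _ => congr_arg toQuotient (smul_mul_assoc _ _ _)⟩

theorem quotientModule_smulCommClass [SMulCommClass K A A] (c : RingCon A)
    (h : ∀ (k : K) (x y : A), c x y → c (k • x) (k • y)) :
    letI := quotientModule c h
    SMulCommClass K c.Quotient c.Quotient :=
  letI := quotientModule c h
  ⟨fun _ => Quotient.ind₂' fun _ _ => congr_arg toQuotient (mul_smul_comm _ _ _).symm⟩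

end RingCon

/-! ### Directed graphs and Leavitt path algebras -/

/-- A directed graph: arbitrary sets of vertices and edges with source and range maps. -/
structure DirectedGraph where
  Vertex : Type v
  Edge : Type w
  src : Edge → Vertex
  rng : Edge → Vertex

namespace DirectedGraph

/-- The generators of the Leavitt path algebra: vertices, edges `e` and ghost edges `e*`. -/
inductive Generator (E : DirectedGraph.{v, w}) : Type (max v w)
  | vertex (a : E.Vertex) : Generator E
  | edge (e : E.Edge) : Generator E
  | ghost (e : E.Edge) : Generator E

end DirectedGraph

namespace LeavittPathAlgebra

open DirectedGraph

variable (K : Type u) [Field K] (E : DirectedGraph.{v, w})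

/-- The free associative non-unital `K`-algebra on the generators. -/
abbrev FreeAlg : Type (max u v w) := MonoidAlgebra K (FreeSemigroup E.Generator)

variable {E} in
/-- A generator, as an element of the free non-unital algebra. -/
noncomputable def gen (x : E.Generator) : FreeAlg K E :=
  MonoidAlgebra.single (FreeSemigroup.of x) 1

/-- The defining relations. In `ck2`, the finset `s` consists of all edges with source `a`,
so that the relation is imposed exactly at the regular vertices. -/
inductive Rel : FreeAlg K E → FreeAlg K E → Prop
  | idem (a : E.Vertex) : Rel (gen K (.vertex a) * gen K (.vertex a)) (gen K (.vertex a))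
  | orth (a b : E.Vertex) (h : a ≠ b) : Rel (gen K (.vertex a) * gen K (.vertex b)) 0
  | src_edge (e : E.Edge) : Rel (gen K (.vertex (E.src e)) * gen K (.edge e)) (gen K (.edge e))
  | edge_rng (e : E.Edge) : Rel (gen K (.edge e) * gen K (.vertex (E.rng e))) (gen K (.edge e))
  | rng_ghost (e : E.Edge) : Rel (gen K (.vertex (E.rng e)) * gen K (.ghost e)) (gen K (.ghost e))
  | ghost_src (e : E.Edge) : Rel (gen K (.ghost e) * gen K (.vertex (E.src e))) (gen K (.ghost e))
  | ck1_same (e : E.Edge) : Rel (gen K (.ghost e) * gen K (.edge e)) (gen K (.vertex (E.rng e)))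
  | ck1_ne (e f : E.Edge) (h : e ≠ f) : Rel (gen K (.ghost e) * gen K (.edge f)) 0
  | ck2 (a : E.Vertex) (s : Finset E.Edge) (hs : ∀ e, e ∈ s ↔ E.src e = a) (hne : s.Nonempty) :
      Rel (gen K (.vertex a)) (∑ e ∈ s, gen K (.edge e) * gen K (.ghost e))

/-- The congruence generated by all scalar multiples of the defining relations: the smallest
`K`-algebra congruence containing them. -/
noncomputable def con : RingCon (FreeAlg K E) :=
  ringConGen fun x y => ∃ (k : K) (a b : FreeAlg K E), Rel K E a b ∧ x = k • a ∧ y = k • b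

theorem con_smul (k : K) (x y : FreeAlg K E) (h : con K E x y) : con K E (k • x) (k • y) := by
  change RingConGen.Rel _ _ _ at h
  induction h with
  | of x y h =>
    obtain ⟨l, a, b, hab, rfl, rfl⟩ := h
    exact RingConGen.Rel.of _ _ ⟨k * l, a, b, hab, (mul_smul _ _ _).symm, (mul_smul _ _ _).symm⟩
  | refl x => exact (con K E).refl _
  | symm _ ih => exact (con K E).symm ih
  | trans _ _ ih1 ih2 => exact (con K E).trans ih1 ih2
  | add _ _ ih1 ih2 =>
    rw [smul_add, smul_add]
    exact (con K E).add ih1 ih2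
  | mul _ h2 ih1 _ =>
    rw [← smul_mul_assoc, ← smul_mul_assoc]
    exact (con K E).mul ih1 h2

end LeavittPathAlgebra

/-- The Leavitt path algebra `L_K(E)`, an associative, not necessarily unital `K`-algebra. -/
def LeavittPathAlgebra (K : Type u) [Field K] (E : DirectedGraph.{v, w}) : Type (max u v w) :=
  (LeavittPathAlgebra.con K E).Quotient

namespace LeavittPathAlgebra

variable (K : Type u) [Field K] (E : DirectedGraph.{v, w})

noncomputable instance : NonUnitalRing (LeavittPathAlgebra K E) :=
  inferInstanceAs (NonUnitalRing (con K E).Quotient)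

noncomputable instance : Module K (LeavittPathAlgebra K E) :=
  RingCon.quotientModule (con K E) (con_smul K E)

instance : IsScalarTower K (LeavittPathAlgebra K E) (LeavittPathAlgebra K E) :=
  RingCon.quotientModule_isScalarTower (con K E) (con_smul K E)

instance : SMulCommClass K (LeavittPathAlgebra K E) (LeavittPathAlgebra K E) :=
  RingCon.quotientModule_smulCommClass (con K E) (con_smul K E)

end LeavittPathAlgebra

/-! ### Prime ideals of rings without identity -/

namespace TwoSidedIdeal

variable {A : Type v} [NonUnitalRing A]

/-- A two-sided ideal `P` is prime if it is proper and `I J ⊆ P` implies `I ⊆ P` or `J ⊆ P` for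
all two-sided ideals `I`, `J`. -/
class IsPrime (P : TwoSidedIdeal A) : Prop where
  ne_top : P ≠ ⊤
  le_or_le : ∀ I J : TwoSidedIdeal A, (∀ x ∈ I, ∀ y ∈ J, x * y ∈ P) → I ≤ P ∨ J ≤ P

/-- `P` is not the intersection of all the prime ideals properly containing it (the
intersection of the empty family being the whole ring). -/
def IsLocallyClosed (P : TwoSidedIdeal A) : Prop :=
  P ≠ sInf {Q : TwoSidedIdeal A | Q.IsPrime ∧ P < Q}

theorem IsPrime.not_top_le {P : TwoSidedIdeal A} (hP : P.IsPrime) : ¬ (⊤ : TwoSidedIdeal A) ≤ P :=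
  fun h => hP.ne_top (top_le_iff.mp h)

theorem IsPrime.mem_of_mul_mem {P : TwoSidedIdeal A} (hP : P.IsPrime) {x : A}
    (h : ∀ r, x * r ∈ P) : x ∈ P := by
  let I : TwoSidedIdeal A := TwoSidedIdeal.mk' {x | ∀ r, x * r ∈ P}
    (fun r => by rw [zero_mul]; exact P.zero_mem)
    (fun hx hy r => by rw [add_mul]; exact P.add_mem (hx r) (hy r))
    (fun hx r => by rw [neg_mul]; exact P.neg_mem (hx r))
    (fun hy r => by rw [mul_assoc]; exact P.mul_mem_left _ _ (hy r))
    (fun hx r => by rw [mul_assoc]; exact hx _)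
  have hI : ∀ y, y ∈ I ↔ ∀ r, y * r ∈ P := fun y => TwoSidedIdeal.mem_mk' _ _ _ _ _ _ y
  rcases hP.le_or_le I ⊤ (fun x hx y _ => (hI x).1 hx y) with h' | h'
  · exact h' ((hI x).2 h)
  · exact absurd h' hP.not_top_le

theorem IsPrime.mem_of_mul_mem' {P : TwoSidedIdeal A} (hP : P.IsPrime) {x : A}
    (h : ∀ r, r * x ∈ P) : x ∈ P := by
  let I : TwoSidedIdeal A := TwoSidedIdeal.mk' {x | ∀ r, r * x ∈ P}
    (fun r => by rw [mul_zero]; exact P.zero_mem)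
    (fun hx hy r => by rw [mul_add]; exact P.add_mem (hx r) (hy r))
    (fun hx r => by rw [mul_neg]; exact P.neg_mem (hx r))
    (fun hy r => by rw [← mul_assoc]; exact hy _)
    (fun hx r => by rw [← mul_assoc]; exact P.mul_mem_right _ _ (hx r))
  have hI : ∀ y, y ∈ I ↔ ∀ r, r * y ∈ P := fun y => TwoSidedIdeal.mem_mk' _ _ _ _ _ _ y
  rcases hP.le_or_le ⊤ I (fun x _ y hy => (hI y).1 hy x) with h' | h'
  · exact absurd h' hP.not_top_le
  · exact h' ((hI x).2 h)

theorem IsPrime.mem_or_mem {P : TwoSidedIdeal A} (hP : P.IsPrime) {a b : A}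
    (h : ∀ r, a * r * b ∈ P) : a ∈ P ∨ b ∈ P := by
  let N : TwoSidedIdeal A := TwoSidedIdeal.mk' {y | ∀ r, a * r * y ∈ P}
    (fun r => by rw [mul_zero]; exact P.zero_mem)
    (fun hx hy r => by rw [mul_add]; exact P.add_mem (hx r) (hy r))
    (fun hx r => by rw [mul_neg]; exact P.neg_mem (hx r))
    (fun {x y} hy r => by rw [← mul_assoc, mul_assoc a r x]; exact hy _)
    (fun hx r => by rw [← mul_assoc]; exact P.mul_mem_right _ _ (hx r))
  have hN : ∀ y, y ∈ N ↔ ∀ r, a * r * y ∈ P := fun y => TwoSidedIdeal.mem_mk' _ _ _ _ _ _ y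
  let M : TwoSidedIdeal A := TwoSidedIdeal.mk' {x | ∀ y ∈ N, ∀ r, x * r * y ∈ P}
    (fun y _ r => by rw [zero_mul, zero_mul]; exact P.zero_mem)
    (fun hx hy z hz r => by rw [add_mul, add_mul]; exact P.add_mem (hx z hz r) (hy z hz r))
    (fun hx z hz r => by rw [neg_mul, neg_mul]; exact P.neg_mem (hx z hz r))
    (fun {x y} hy z hz r => by
      rw [mul_assoc, mul_assoc, ← mul_assoc y]; exact P.mul_mem_left _ _ (hy z hz r))
    (fun {x y} hx z hz r => by rw [mul_assoc x]; exact hx z hz _)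
  have hM : ∀ x, x ∈ M ↔ ∀ y ∈ N, ∀ r, x * r * y ∈ P :=
    fun y => TwoSidedIdeal.mem_mk' _ _ _ _ _ _ y
  let J : TwoSidedIdeal A := TwoSidedIdeal.mk' {z | ∀ x ∈ M, x * z ∈ P}
    (fun x _ => by rw [mul_zero]; exact P.zero_mem)
    (fun hy hz x hx => by rw [mul_add]; exact P.add_mem (hy x hx) (hz x hx))
    (fun hz x hx => by rw [mul_neg]; exact P.neg_mem (hz x hx))
    (fun hz x hx => by rw [← mul_assoc]; exact hz _ (M.mul_mem_right _ _ hx))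
    (fun hz x hx => by rw [← mul_assoc]; exact P.mul_mem_right _ _ (hz x hx))
  have hJ : ∀ z, z ∈ J ↔ ∀ x ∈ M, x * z ∈ P := fun y => TwoSidedIdeal.mem_mk' _ _ _ _ _ _ y
  rcases hP.le_or_le M J (fun x hx z hz => (hJ z).1 hz x hx) with h' | h'
  · exact Or.inl (h' ((hM a).2 fun y hy => (hN y).1 hy))
  · refine Or.inr (hP.mem_of_mul_mem' fun r => h' ((hJ _).2 fun x hx => ?_))
    rw [← mul_assoc]
    exact (hM x).1 hx b ((hN b).2 h) r

/-- A prime ideal of a `K`-algebra is automatically a `K`-subspace. -/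
theorem IsPrime.smul_mem {K : Type u} [CommSemiring K] [Module K A] [IsScalarTower K A A]
    [SMulCommClass K A A] {P : TwoSidedIdeal A} (hP : P.IsPrime) (k : K) {x : A} (hx : x ∈ P) :
    k • x ∈ P := by
  refine hP.mem_of_mul_mem fun r => ?_
  rw [smul_mul_assoc, ← mul_smul_comm]
  exact P.mul_mem_right _ _ hx

theorem IsPrime.ringCon_smul {K : Type u} [CommRing K] [Module K A] [IsScalarTower K A A]
    [SMulCommClass K A A] {P : TwoSidedIdeal A} (hP : P.IsPrime) (k : K) (x y : A)
    (h : P.ringCon x y) : P.ringCon (k • x) (k • y) := by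
  rw [rel_iff] at h ⊢
  rw [← smul_sub]
  exact hP.smul_mem k h

/-- The product ideal `I J`: all finite sums of products `x * y` with `x ∈ I` and `y ∈ J`. -/
def prod (I J : TwoSidedIdeal A) : TwoSidedIdeal A :=
  TwoSidedIdeal.mk' (AddSubgroup.closure {z : A | ∃ x ∈ I, ∃ y ∈ J, z = x * y} : Set A)
    (AddSubgroup.zero_mem _)
    (fun hx hy => AddSubgroup.add_mem _ hx hy)
    (fun hx => AddSubgroup.neg_mem _ hx)
    (fun {r z} hz => by
      refine AddSubgroup.closure_induction (p := fun z _ => r * z ∈ AddSubgroup.closure _)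
        ?_ ?_ ?_ ?_ hz
      · rintro _ ⟨x, hx, y, hy, rfl⟩
        exact AddSubgroup.subset_closure
          ⟨r * x, I.mul_mem_left _ _ hx, y, hy, (mul_assoc _ _ _).symm⟩
      · rw [mul_zero]; exact AddSubgroup.zero_mem _
      · intro a b _ _ ha hb; rw [mul_add]; exact AddSubgroup.add_mem _ ha hb
      · intro a _ ha; rw [mul_neg]; exact AddSubgroup.neg_mem _ ha)
    (fun {z r} hz => by
      refine AddSubgroup.closure_induction (p := fun z _ => z * r ∈ AddSubgroup.closure _)
        ?_ ?_ ?_ ?_ hz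
      · rintro _ ⟨x, hx, y, hy, rfl⟩
        exact AddSubgroup.subset_closure
          ⟨x, hx, y * r, J.mul_mem_right _ _ hy, mul_assoc _ _ _⟩
      · rw [zero_mul]; exact AddSubgroup.zero_mem _
      · intro a b _ _ ha hb; rw [add_mul]; exact AddSubgroup.add_mem _ ha hb
      · intro a _ ha; rw [neg_mul]; exact AddSubgroup.neg_mem _ ha)

theorem mem_prod {I J : TwoSidedIdeal A} {z : A} :
    z ∈ prod I J ↔ z ∈ AddSubgroup.closure {z : A | ∃ x ∈ I, ∃ y ∈ J, z = x * y} :=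
  TwoSidedIdeal.mem_mk' _ _ _ _ _ _ z

theorem mul_mem_prod {I J : TwoSidedIdeal A} {x y : A} (hx : x ∈ I) (hy : y ∈ J) :
    x * y ∈ prod I J :=
  mem_prod.2 (AddSubgroup.subset_closure ⟨x, hx, y, hy, rfl⟩)

theorem prod_le_left (I J : TwoSidedIdeal A) : prod I J ≤ I := fun z hz => by
  refine AddSubgroup.closure_induction (p := fun z _ => z ∈ I) ?_ ?_ ?_ ?_ (mem_prod.1 hz)
  · rintro _ ⟨x, hx, y, hy, rfl⟩
    exact I.mul_mem_right _ _ hx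
  · exact I.zero_mem
  · intro a b _ _ ha hb; exact I.add_mem ha hb
  · intro a _ ha; exact I.neg_mem ha

end TwoSidedIdeal

/-- A ring (not necessarily unital) is prime if its zero ideal is prime. -/
class IsPrimeRing (A : Type v) [NonUnitalRing A] : Prop where
  bot_isPrime : (⊥ : TwoSidedIdeal A).IsPrime

namespace IsPrimeRing

open TwoSidedIdeal

variable {A : Type v} [NonUnitalRing A] [IsPrimeRing A]

theorem top_ne_bot : (⊤ : TwoSidedIdeal A) ≠ ⊥ := (bot_isPrime (A := A)).ne_top.symm

theorem prod_ne_bot {I J : TwoSidedIdeal A} (hI : I ≠ ⊥) (hJ : J ≠ ⊥) : prod I J ≠ ⊥ := by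
  intro h
  rcases (bot_isPrime (A := A)).le_or_le I J
    (fun x hx y hy => h ▸ mul_mem_prod hx hy) with h' | h'
  · exact hI (le_bot_iff.mp h')
  · exact hJ (le_bot_iff.mp h')

theorem inf_ne_bot {I J : TwoSidedIdeal A} (hI : I ≠ ⊥) (hJ : J ≠ ⊥) : I ⊓ J ≠ ⊥ := by
  intro h
  rcases (bot_isPrime (A := A)).le_or_le I J
    (fun x hx y hy => h ▸ ((TwoSidedIdeal.mem_inf _).2
      ⟨I.mul_mem_right _ _ hx, J.mul_mem_left _ _ hy⟩)) with h' | h'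
  · exact hI (le_bot_iff.mp h')
  · exact hJ (le_bot_iff.mp h')

theorem eq_zero_of_mul {I : TwoSidedIdeal A} (hI : I ≠ ⊥) {x : A} (h : ∀ y ∈ I, x * y = 0) :
    x = 0 := by
  by_contra hx
  apply hI
  rw [← le_bot_iff]
  intro y hy
  refine ((bot_isPrime (A := A)).mem_or_mem (a := x) (b := y) fun r => ?_).resolve_left
    (fun h' => hx ((TwoSidedIdeal.mem_bot _).1 h'))
  rw [TwoSidedIdeal.mem_bot, mul_assoc]
  exact h _ (I.mul_mem_left _ _ hy)

end IsPrimeRing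

instance TwoSidedIdeal.isPrimeRing_quotient {A : Type v} [NonUnitalRing A] (P : TwoSidedIdeal A)
    [hP : P.IsPrime] : IsPrimeRing P.ringCon.Quotient where
  bot_isPrime := by
    have key : ∀ x : A, (x : P.ringCon.Quotient) = 0 ↔ x ∈ P := fun x => by
      rw [← RingCon.coe_zero, RingCon.eq, P.mem_iff]
    let I' (I : TwoSidedIdeal P.ringCon.Quotient) : TwoSidedIdeal A :=
      TwoSidedIdeal.mk' {x : A | (x : P.ringCon.Quotient) ∈ I}
        I.zero_mem (fun hx hy => I.add_mem hx hy) (fun hx => I.neg_mem hx)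
        (fun {x y} hy => I.mul_mem_left (x : P.ringCon.Quotient) (y : P.ringCon.Quotient) hy)
        (fun {x y} hx => I.mul_mem_right (x : P.ringCon.Quotient) (y : P.ringCon.Quotient) hx)
    have hI' : ∀ I x, x ∈ I' I ↔ (x : P.ringCon.Quotient) ∈ I :=
      fun I x => TwoSidedIdeal.mem_mk' _ _ _ _ _ _ x
    have hle : ∀ I, I' I ≤ P → I ≤ ⊥ := fun I h => by
      intro q
      induction q using Quotient.inductionOn' with
      | h x => exact fun hx => (TwoSidedIdeal.mem_bot _).2 ((key x).2 (h ((hI' I x).2 hx)))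
    refine ⟨fun h => hP.ne_top (top_le_iff.mp fun x _ => (key x).1 ?_), fun I J h => ?_⟩
    · rw [← TwoSidedIdeal.mem_bot P.ringCon.Quotient, h]
      trivial
    · refine (hP.le_or_le (I' I) (I' J) fun x hx y hy => (key _).1 ?_).imp (hle I) (hle J)
      exact (TwoSidedIdeal.mem_bot _).1 (h _ ((hI' I x).1 hx) _ ((hI' J y).1 hy))

section QuotientAlgebra

variable (K : Type u) [CommRing K] {A : Type v} [NonUnitalRing A] [Module K A]
  [IsScalarTower K A A] [SMulCommClass K A A] (P : TwoSidedIdeal A) [hP : P.IsPrime]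

instance TwoSidedIdeal.quotientModule : Module K P.ringCon.Quotient :=
  RingCon.quotientModule P.ringCon hP.ringCon_smul

instance TwoSidedIdeal.quotient_isScalarTower :
    IsScalarTower K P.ringCon.Quotient P.ringCon.Quotient :=
  RingCon.quotientModule_isScalarTower P.ringCon hP.ringCon_smul

instance TwoSidedIdeal.quotient_smulCommClass :
    SMulCommClass K P.ringCon.Quotient P.ringCon.Quotient :=
  RingCon.quotientModule_smulCommClass P.ringCon hP.ringCon_smul

end QuotientAlgebra

/-! ### The Martindale ring of quotients and the extended centroid -/

/-- A pair `(I, f)` of a nonzero two-sided ideal `I` of `A` and a homomorphism `f : I → A` of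
right `A`-modules. -/
structure PartialHom (A : Type v) [NonUnitalRing A] where
  dom : TwoSidedIdeal A
  dom_ne_bot : dom ≠ ⊥
  toFun : dom →+ A
  map_mul : ∀ (x : dom) (a : A), toFun ⟨x.1 * a, dom.mul_mem_right _ _ x.2⟩ = toFun x * a

namespace PartialHom

open TwoSidedIdeal

variable {A : Type v} [NonUnitalRing A]

/-- The value `f x` at an element `x` of the domain of `f`. -/
def app (f : PartialHom A) (x : A) (hx : x ∈ f.dom) : A := f.toFun ⟨x, hx⟩

theorem app_add (f : PartialHom A) {x y : A} (hx : x ∈ f.dom) (hy : y ∈ f.dom) :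
    f.app (x + y) (f.dom.add_mem hx hy) = f.app x hx + f.app y hy :=
  f.toFun.map_add ⟨x, hx⟩ ⟨y, hy⟩

theorem app_zero (f : PartialHom A) : f.app 0 f.dom.zero_mem = 0 := f.toFun.map_zero

theorem app_neg (f : PartialHom A) {x : A} (hx : x ∈ f.dom) :
    f.app (-x) (f.dom.neg_mem hx) = -f.app x hx :=
  f.toFun.map_neg ⟨x, hx⟩

theorem app_mul (f : PartialHom A) {x : A} (hx : x ∈ f.dom) (a : A) :
    f.app (x * a) (f.dom.mul_mem_right _ _ hx) = f.app x hx * a :=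
  f.map_mul ⟨x, hx⟩ a

/-- Build a pair `(I, f)` from `f : (x : A) → x ∈ I → A`. -/
def ofApp (I : TwoSidedIdeal A) (hI : I ≠ ⊥) (f : (x : A) → x ∈ I → A)
    (hadd : ∀ x y (hx : x ∈ I) (hy : y ∈ I), f (x + y) (I.add_mem hx hy) = f x hx + f y hy)
    (hmul : ∀ x a (hx : x ∈ I), f (x * a) (I.mul_mem_right _ _ hx) = f x hx * a) :
    PartialHom A where
  dom := I
  dom_ne_bot := hI
  toFun := AddMonoidHom.mk' (fun x => f x.1 x.2) fun x y => hadd x.1 y.1 x.2 y.2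
  map_mul x a := hmul x.1 a x.2

theorem app_mem (f : PartialHom A) {I : TwoSidedIdeal A} {x : A} (hx : x ∈ prod f.dom I) :
    f.app x (prod_le_left _ _ hx) ∈ I := by
  suffices h : ∃ h : x ∈ f.dom, f.app x h ∈ I from h.2
  refine AddSubgroup.closure_induction (p := fun z _ => ∃ h : z ∈ f.dom, f.app z h ∈ I)
    ?_ ?_ ?_ ?_ (mem_prod.1 hx)
  · rintro _ ⟨x, hx, y, hy, rfl⟩
    exact ⟨f.dom.mul_mem_right _ _ hx, by rw [f.app_mul hx]; exact I.mul_mem_left _ _ hy⟩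
  · exact ⟨f.dom.zero_mem, by rw [f.app_zero]; exact I.zero_mem⟩
  · rintro a b _ _ ⟨ha, ha'⟩ ⟨hb, hb'⟩
    exact ⟨f.dom.add_mem ha hb, by rw [f.app_add ha hb]; exact I.add_mem ha' hb'⟩
  · rintro a _ ⟨ha, ha'⟩
    exact ⟨f.dom.neg_mem ha, by rw [f.app_neg ha]; exact I.neg_mem ha'⟩

theorem app_congr {f : PartialHom A} {x y : A} (h : x = y) (hx : x ∈ f.dom) (hy : y ∈ f.dom) :
    f.app x hx = f.app y hy := by
  subst h; rfl

variable [IsPrimeRing A]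

/-- Two pairs are equivalent if the maps agree on the intersection of their domains. -/
instance setoid (A : Type v) [NonUnitalRing A] [IsPrimeRing A] : Setoid (PartialHom A) where
  r f g := ∀ (x : A) (hf : x ∈ f.dom) (hg : x ∈ g.dom), f.app x hf = g.app x hg
  iseqv :=
    { refl := fun _ _ _ _ => rfl
      symm := fun h x hf hg => (h x hg hf).symm
      trans := fun {f g h} hfg hgh x hf hh => by
        rw [← sub_eq_zero]
        refine IsPrimeRing.eq_zero_of_mul g.dom_ne_bot fun y hy => ?_
        have hxy : x * y ∈ g.dom := g.dom.mul_mem_left _ _ hy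
        rw [sub_mul, sub_eq_zero, ← f.app_mul, ← h.app_mul]
        exact (hfg _ (f.dom.mul_mem_right _ _ hf) hxy).trans
          (hgh _ hxy (h.dom.mul_mem_right _ _ hh)) }

/-- `(I, f) + (J, g) = (I ∩ J, f + g)`. -/
def add (f g : PartialHom A) : PartialHom A :=
  ofApp (f.dom ⊓ g.dom) (IsPrimeRing.inf_ne_bot f.dom_ne_bot g.dom_ne_bot)
    (fun x hx => f.app x ((TwoSidedIdeal.mem_inf _).1 hx).1 + g.app x ((TwoSidedIdeal.mem_inf _).1 hx).2)
    (fun x y hx hy => by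
      rw [f.app_add ((TwoSidedIdeal.mem_inf _).1 hx).1 ((TwoSidedIdeal.mem_inf _).1 hy).1,
        g.app_add ((TwoSidedIdeal.mem_inf _).1 hx).2 ((TwoSidedIdeal.mem_inf _).1 hy).2]
      abel)
    (fun x a hx => by
      rw [f.app_mul ((TwoSidedIdeal.mem_inf _).1 hx).1, g.app_mul ((TwoSidedIdeal.mem_inf _).1 hx).2,
        add_mul])

/-- `-(I, f) = (I, -f)`. -/
def neg (f : PartialHom A) : PartialHom A :=
  ofApp f.dom f.dom_ne_bot (fun x hx => -f.app x hx)
    (fun x y hx hy => by rw [f.app_add hx hy, neg_add])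
    (fun x a hx => by rw [f.app_mul hx, neg_mul])

/-- `(I, f) (J, g) = (J I, f ∘ g)`; note that `g (J I) = g (J) I ⊆ I`. -/
def comp (f g : PartialHom A) : PartialHom A :=
  ofApp (prod g.dom f.dom) (IsPrimeRing.prod_ne_bot g.dom_ne_bot f.dom_ne_bot)
    (fun x hx => f.app (g.app x (prod_le_left _ _ hx)) (g.app_mem hx))
    (fun x y hx hy => by
      simp only [g.app_add (prod_le_left _ _ hx) (prod_le_left _ _ hy)]
      exact f.app_add (g.app_mem hx) (g.app_mem hy))
    (fun x a hx => by
      simp only [g.app_mul (prod_le_left _ _ hx)]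
      exact f.app_mul (g.app_mem hx) a)

/-- `(A, a ↦ k a)`. -/
def scalar {K : Type u} [CommRing K] [Module K A] [IsScalarTower K A A] (k : K) : PartialHom A :=
  ofApp ⊤ IsPrimeRing.top_ne_bot (fun x _ => k • x) (fun _ _ _ _ => smul_add _ _ _)
    (fun _ _ _ => (smul_mul_assoc _ _ _).symm)

/-- The homomorphisms are automatically `K`-linear. -/
theorem app_smul {K : Type u} [CommRing K] [Module K A] [IsScalarTower K A A] [SMulCommClass K A A]
    (f : PartialHom A) (k : K) {x : A} (hx : x ∈ f.dom) (hkx : k • x ∈ f.dom) :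
    f.app (k • x) hkx = k • f.app x hx := by
  rw [← sub_eq_zero]
  refine IsPrimeRing.eq_zero_of_mul IsPrimeRing.top_ne_bot fun y _ => ?_
  have e : k • x * y = x * (k • y) := by rw [smul_mul_assoc, mul_smul_comm]
  rw [sub_mul, sub_eq_zero, ← f.app_mul,
    app_congr e _ (f.dom.mul_mem_right _ _ hx), f.app_mul hx, mul_smul_comm, smul_mul_assoc]

end PartialHom

/-- The Martindale ring of (right) quotients of a prime ring `A`. -/
def MartindaleQuotient (A : Type v) [NonUnitalRing A] [IsPrimeRing A] : Type v :=
  Quotient (PartialHom.setoid A)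

namespace MartindaleQuotient

open PartialHom (app_congr)

variable {A : Type v} [NonUnitalRing A] [IsPrimeRing A]

/-- The class of a pair `(I, f)`. -/
def mk (f : PartialHom A) : MartindaleQuotient A := Quotient.mk _ f

instance : Add (MartindaleQuotient A) :=
  ⟨Quotient.map₂ PartialHom.add fun _ _ hf _ _ hg x h h' =>
    congr_arg₂ (· + ·) (hf x ((TwoSidedIdeal.mem_inf _).1 h).1 ((TwoSidedIdeal.mem_inf _).1 h').1)
      (hg x ((TwoSidedIdeal.mem_inf _).1 h).2 ((TwoSidedIdeal.mem_inf _).1 h').2)⟩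

instance : Neg (MartindaleQuotient A) :=
  ⟨Quotient.map PartialHom.neg fun _ _ hf x h h' => congr_arg (- ·) (hf x h h')⟩

instance : Mul (MartindaleQuotient A) :=
  ⟨Quotient.map₂ PartialHom.comp fun f f' hf g g' hg x h h' => by
    have e := hg x (TwoSidedIdeal.prod_le_left _ _ h) (TwoSidedIdeal.prod_le_left _ _ h')
    have m : g.app x (TwoSidedIdeal.prod_le_left _ _ h) ∈ f'.dom := e ▸ g'.app_mem h'
    exact (hf _ (g.app_mem h) m).trans (app_congr e m (g'.app_mem h'))⟩

instance : Zero (MartindaleQuotient A) := ⟨mk (PartialHom.scalar (0 : ℤ))⟩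

instance : One (MartindaleQuotient A) := ⟨mk (PartialHom.scalar (1 : ℤ))⟩

instance : Ring (MartindaleQuotient A) where
  add_assoc a b c := by
    induction a using Quotient.inductionOn
    induction b using Quotient.inductionOn
    induction c using Quotient.inductionOn
    exact Quotient.sound fun x h h' => add_assoc _ _ _
  zero_add a := by
    induction a using Quotient.inductionOn
    refine Quotient.sound fun x h h' => ?_
    exact (congr_arg (· + _) (zero_smul ℤ x)).trans (zero_add _)
  add_zero a := by
    induction a using Quotient.inductionOn
    refine Quotient.sound fun x h h' => ?_
    exact (congr_arg (_ + ·) (zero_smul ℤ x)).trans (add_zero _)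
  add_comm a b := by
    induction a using Quotient.inductionOn
    induction b using Quotient.inductionOn
    exact Quotient.sound fun x h h' => add_comm _ _
  neg_add_cancel a := by
    induction a using Quotient.inductionOn
    refine Quotient.sound fun x h h' => ?_
    exact (neg_add_cancel _).trans (zero_smul ℤ x).symm
  mul_assoc a b c := by
    induction a using Quotient.inductionOn
    induction b using Quotient.inductionOn
    induction c using Quotient.inductionOn
    exact Quotient.sound fun x h h' => rfl
  one_mul a := by
    induction a using Quotient.inductionOn
    exact Quotient.sound fun x h h' => one_smul ℤ _
  mul_one a := by
    induction a using Quotient.inductionOn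
    exact Quotient.sound fun x h h' => app_congr (one_smul ℤ x) _ _
  zero_mul a := by
    induction a using Quotient.inductionOn
    exact Quotient.sound fun x h h' => (zero_smul ℤ _).trans (zero_smul ℤ _).symm
  mul_zero a := by
    induction a using Quotient.inductionOn with | h f => ?_
    refine Quotient.sound fun x h h' => ?_
    exact (app_congr (zero_smul ℤ x) _ f.dom.zero_mem).trans
      (f.app_zero.trans (zero_smul ℤ x).symm)
  left_distrib a b c := by
    induction a using Quotient.inductionOn with | h f => ?_
    induction b using Quotient.inductionOn
    induction c using Quotient.inductionOn
    exact Quotient.sound fun x h h' => f.app_add _ _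
  right_distrib a b c := by
    induction a using Quotient.inductionOn
    induction b using Quotient.inductionOn
    induction c using Quotient.inductionOn
    exact Quotient.sound fun x h h' => rfl
  nsmul := nsmulRec
  zsmul := zsmulRec

variable {K : Type u} [CommRing K] [Module K A] [IsScalarTower K A A] [SMulCommClass K A A]

/-- `k ∈ K` is sent to the class of `(A, a ↦ k a)`. -/
def scalarHom (K : Type u) [CommRing K] (A : Type v) [NonUnitalRing A] [IsPrimeRing A]
    [Module K A] [IsScalarTower K A A] : K →+* MartindaleQuotient A where
  toFun k := mk (PartialHom.scalar k)
  map_zero' := Quotient.sound fun x _ _ => (zero_smul K x).trans (zero_smul ℤ x).symm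
  map_one' := Quotient.sound fun x _ _ => (one_smul K x).trans (one_smul ℤ x).symm
  map_add' k l := Quotient.sound fun x _ _ => add_smul k l x
  map_mul' k l := Quotient.sound fun x _ _ => mul_smul k l x

instance : Algebra K (MartindaleQuotient A) :=
  RingHom.toAlgebra' (scalarHom K A) fun k a => by
    induction a using Quotient.inductionOn with | h f => ?_
    exact Quotient.sound fun x h h' => (f.app_smul k _ _).symm

end MartindaleQuotient

/-- The extended centroid of a prime `K`-algebra: the center of its Martindale ring of quotients,
as a `K`-algebra. -/
def extendedCentroid (K : Type u) [CommRing K] (A : Type v) [NonUnitalRing A] [IsPrimeRing A]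
    [Module K A] [IsScalarTower K A A] [SMulCommClass K A A] :
    Subalgebra K (MartindaleQuotient A) :=
  Subalgebra.center K (MartindaleQuotient A)

/-- A prime ideal `P` of a `K`-algebra `A` is rational if the extended centroid of `A / P` is
algebraic over `K`. -/
def TwoSidedIdeal.IsRational (K : Type u) [Field K] {A : Type v} [NonUnitalRing A] [Module K A]
    [IsScalarTower K A A] [SMulCommClass K A A] (P : TwoSidedIdeal A) [P.IsPrime] : Prop :=
  Algebra.IsAlgebraic K (extendedCentroid K P.ringCon.Quotient)

/-! Put `A = L/P`, a prime ring. The images of vertices, edges and ghost edges generate `A` and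
satisfy every Leavitt relation except possibly `v = ∑ e e*`, since edges may die in the quotient.
The shape of the graph of surviving vertices decides between two mechanisms.

If some nonzero idempotent `q` has a commutative corner `B = qAq` of finite type over `K`, local
closedness does the work. Each prime of `B` has a prime of `A` lying over it. As `P` is locally
closed, all nonzero primes of `A` share a nonzero element. By primeness of `A`, some compression of
that element to `B` is nonzero, yet it lies in every nonzero maximal ideal of `B`. Since `B` is a
Jacobson domain, it must be a field, and by Zariski's lemma it is algebraic over `K`. Then `q` lies
in every nonzero ideal, a central `z` satisfies `zq ∈ B`, and a polynomial that kills `zq` kills `z`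
(`TwoSidedIdeal.isRational_of_commCorner`).

Such a corner exists in two cases. Some surviving vertex `x` may have only finitely many surviving
edges and still differ from `∑ e e*`; then `q = x - ∑ e e*` has corner `Kq`
(`hasCommCorner_of_not_isLeavitt`). Or there is a cycle whose vertices each emit a single surviving
edge; then the corner at a vertex of the cycle is a quotient of `K[t, t⁻¹]`
(`hasCommCorner_of_isolatedCycle`).

Otherwise every surviving vertex starts surviving paths `q` that are aperiodic to any prescribed
order (`hasAperiodicPaths_or`). The map `a ↦ q* a q` then turns a given element into a scalar
multiple of a vertex. This shows that every nonzero ideal contains a surviving vertex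
(`exists_vert_mem`) and that every element of the extended centroid acts as a scalar. -/

namespace IsPrimeRing

variable {A : Type v} [NonUnitalRing A] [IsPrimeRing A]

theorem eq_zero_or_eq_zero {a b : A} (h : ∀ r, a * r * b = 0) : a = 0 ∨ b = 0 := by
  simpa only [TwoSidedIdeal.mem_bot] using
    (bot_isPrime (A := A)).mem_or_mem (a := a) (b := b)
      fun r => (TwoSidedIdeal.mem_bot _).2 (h r)

theorem exists_mul_mul_ne_zero {a b : A} (ha : a ≠ 0) (hb : b ≠ 0) : ∃ r, a * r * b ≠ 0 := by
  by_contra! h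
  exact (eq_zero_or_eq_zero h).elim ha hb

end IsPrimeRing

/-! ### Embedding a prime ring in its Martindale ring of quotients -/

namespace MartindaleQuotient

variable {A : Type v} [NonUnitalRing A] [IsPrimeRing A]

/-- The embedding of `A` into its Martindale ring of quotients by left multiplications. -/
def of (a : A) : MartindaleQuotient A :=
  mk (PartialHom.ofApp ⊤ IsPrimeRing.top_ne_bot (fun x _ => a * x) (fun _ _ _ _ => mul_add _ _ _)
    (fun _ _ _ => (mul_assoc _ _ _).symm))

theorem of_add (a b : A) : of (a + b) = of a + of b :=
  Quotient.sound fun x _ _ => add_mul a b x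

theorem of_mul (a b : A) : of (a * b) = of a * of b :=
  Quotient.sound fun x _ _ => mul_assoc a b x

theorem of_zero : of (0 : A) = 0 :=
  Quotient.sound fun x _ _ => (zero_mul x).trans (zero_smul ℤ x).symm

theorem of_injective : Function.Injective (of : A → MartindaleQuotient A) := fun a b h => by
  rw [← sub_eq_zero]
  refine IsPrimeRing.eq_zero_of_mul IsPrimeRing.top_ne_bot fun y _ => ?_
  rw [sub_mul, sub_eq_zero]
  exact Quotient.exact h y trivial trivial

theorem algebraMap_mul_of {K : Type u} [CommRing K] [Module K A] [IsScalarTower K A A]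
    [SMulCommClass K A A] (k : K) (a : A) :
    algebraMap K (MartindaleQuotient A) k * of a = of (k • a) :=
  Quotient.sound fun x _ _ => (smul_mul_assoc k a x).symm

theorem mk_mul_of (f : PartialHom A) {a : A} (ha : a ∈ f.dom) : mk f * of a = of (f.app a ha) :=
  Quotient.sound fun x _ _ => f.app_mul ha x

/-- Every element of the Martindale ring of quotients maps a nonzero ideal of `A` into `A`. -/
theorem exists_ideal (z : MartindaleQuotient A) :
    ∃ I : TwoSidedIdeal A, I ≠ ⊥ ∧ ∀ a ∈ I, ∃ b, z * of a = of b := by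
  induction z using Quotient.inductionOn with | h f => ?_
  exact ⟨f.dom, f.dom_ne_bot, fun a ha => ⟨_, mk_mul_of f ha⟩⟩

theorem eq_zero_of_mul_of (z : MartindaleQuotient A) (h : ∀ a, z * of a = 0) : z = 0 := by
  induction z using Quotient.inductionOn with | h f => ?_
  refine Quotient.sound fun x hx _ => ?_
  exact (of_injective ((mk_mul_of f hx).symm.trans ((h x).trans of_zero.symm))).trans
    (zero_smul ℤ x).symm

/-- Nonzero central elements are not zero divisors against `A`: this is the step that carries a
relation on one idempotent over to the whole extended centroid. -/
theorem eq_zero_of_central_mul_of {z : MartindaleQuotient A} (hz : ∀ y, y * z = z * y) {q : A}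
    (hq : q ≠ 0) (h : z * of q = 0) : z = 0 := by
  obtain ⟨I, hI, hI'⟩ := exists_ideal z
  have key : ∀ a ∈ I, z * of a = 0 := by
    intro a ha
    obtain ⟨b, hb⟩ := hI' a ha
    refine hb.trans (of_zero (A := A) ▸ congrArg of ?_)
    -- With `b = za`, centrality gives `b r q = a r (zq) = 0` for all `r`, so primeness forces `b =
    -- 0`.
    refine (IsPrimeRing.eq_zero_or_eq_zero (b := q) fun r => of_injective ?_).resolve_right hq
    rw [of_mul, of_mul, ← hb, mul_assoc, mul_assoc, ← of_mul, ← of_mul, ← mul_assoc a, of_mul,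
      ← mul_assoc, ← hz, mul_assoc, h, mul_zero, of_zero]
  refine eq_zero_of_mul_of z fun a => ?_
  by_contra hza
  obtain ⟨d, hd, hd0⟩ : ∃ d ∈ I, d ≠ 0 := by
    by_contra! h0
    exact hI (le_bot_iff.mp fun d hd => (TwoSidedIdeal.mem_bot _).2 (h0 d hd))
  apply hza
  -- `z * of a` annihilates the nonzero ideal `I`
  have h2 : ∀ x ∈ I, z * of a * of x = 0 := fun x hx => by
    rw [mul_assoc, ← of_mul]; exact key _ (I.mul_mem_left _ _ hx)
  generalize z * of a = y at h2
  induction y using Quotient.inductionOn with | h f => ?_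
  refine Quotient.sound fun x hx _ => ?_
  refine Eq.trans ?_ (zero_smul ℤ x).symm
  refine IsPrimeRing.eq_zero_of_mul hI fun y hy => ?_
  rw [← f.app_mul hx]
  have hxy := f.dom.mul_mem_right x y hx
  exact of_injective ((mk_mul_of f hxy).symm.trans ((h2 _ (I.mul_mem_left _ _ hy)).trans
    of_zero.symm))

end MartindaleQuotient

/-! ### Commutative corners and the primes lying over theirs -/

/-- A corner `q A q` of `A`, presented as an injective image of a unital commutative algebra. -/
structure CommCorner (K : Type u) [Field K] (A : Type v) [NonUnitalRing A] [Module K A]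
    (B : Type w) [CommRing B] [Algebra K B] where
  toLinearMap : B →ₗ[K] A
  map_mul : ∀ x y, toLinearMap (x * y) = toLinearMap x * toLinearMap y
  injective : Function.Injective toLinearMap
  compress : A →+ B
  compress_spec : ∀ a, toLinearMap (compress a) = toLinearMap 1 * a * toLinearMap 1

namespace CommCorner

variable {K : Type u} [Field K] {A : Type v} [NonUnitalRing A] [Module K A]
  {B : Type w} [CommRing B] [Algebra K B] (j : CommCorner K A B)

theorem one_mul (b : B) : j.toLinearMap 1 * j.toLinearMap b = j.toLinearMap b := by
  rw [← j.map_mul, _root_.one_mul]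

theorem mul_one (b : B) : j.toLinearMap b * j.toLinearMap 1 = j.toLinearMap b := by
  rw [← j.map_mul, _root_.mul_one]

theorem compress_map (b : B) : j.compress (j.toLinearMap b) = b := by
  apply j.injective
  rw [compress_spec, one_mul, mul_one]

/-- Compression `a ↦ qaq` is not multiplicative in general; it becomes so once `q` is inserted in
the middle. -/
theorem compress_mul_one_mul (a b : A) :
    j.compress (a * j.toLinearMap 1 * b) = j.compress a * j.compress b := by
  apply j.injective
  have h : j.toLinearMap 1 * (j.toLinearMap 1 * (b * j.toLinearMap 1)) =
      j.toLinearMap 1 * (b * j.toLinearMap 1) := by rw [← mul_assoc, j.one_mul]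
  simp only [j.map_mul, compress_spec, mul_assoc, h]

theorem compress_mul_map (a : A) (b : B) :
    j.compress (a * j.toLinearMap b) = j.compress a * b := by
  conv_lhs => rw [← j.one_mul b, ← mul_assoc, compress_mul_one_mul, compress_map]

theorem map_one_ne_zero [Nontrivial B] : j.toLinearMap 1 ≠ 0 := fun h =>
  one_ne_zero (j.injective (h.trans j.toLinearMap.map_zero.symm))

/-- Primeness used twice, on either side of `a`: every nonzero ideal of `A` meets the corner
nontrivially. -/
theorem exists_compress_ne_zero (j : CommCorner K A B) [IsPrimeRing A] [Nontrivial B]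
    {a : A} (ha : a ≠ 0) :
    ∃ r s, j.compress (r * a * s) ≠ 0 := by
  have h1 := j.map_one_ne_zero
  obtain ⟨r, hr⟩ := IsPrimeRing.exists_mul_mul_ne_zero h1 ha
  obtain ⟨s, hs⟩ := IsPrimeRing.exists_mul_mul_ne_zero hr h1
  refine ⟨r, s, fun h => hs ?_⟩
  have := j.compress_spec (r * a * s)
  rw [h, map_zero] at this
  rw [this]
  simp only [mul_assoc]

/-- If `xy = 0` in the corner, then `x r y = x (q r q) y = (q r q) x y = 0` for all `r` by
commutativity, and primeness of `A` applies. -/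
theorem isDomain (j : CommCorner K A B) [IsPrimeRing A] [Nontrivial B] : IsDomain B := by
  have : NoZeroDivisors B := ⟨fun {x y} hxy => by
    have h0 : ∀ {x : B}, j.toLinearMap x = 0 → x = 0 := fun h =>
      j.injective (h.trans j.toLinearMap.map_zero.symm)
    refine (IsPrimeRing.eq_zero_or_eq_zero (a := j.toLinearMap x) (b := j.toLinearMap y)
      fun r => ?_).imp h0 h0
    rw [← j.mul_one x, ← j.one_mul y, mul_assoc, mul_assoc, ← mul_assoc r,
      ← mul_assoc _ _ (j.toLinearMap y), ← mul_assoc _ r,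
      ← compress_spec, ← j.map_mul, ← j.map_mul, mul_left_comm, hxy, mul_zero, map_zero]⟩
  exact NoZeroDivisors.to_isDomain B

/-- The ideal of `A` lying over an ideal `M` of a commutative corner. -/
def overIdeal (M : Ideal B) : TwoSidedIdeal A :=
  TwoSidedIdeal.mk' {x : A | ∀ r s, j.compress (r * x * s) ∈ M}
    (fun r s => by simp)
    (fun hx hy r s => by rw [mul_add, add_mul, map_add]; exact M.add_mem (hx r s) (hy r s))
    (fun hx r s => by
      rw [mul_neg, neg_mul, map_neg]; exact M.neg_mem (hx r s))
    (fun hy r s => by rw [← mul_assoc]; exact hy _ s)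
    (fun hx r s => by rw [← mul_assoc, mul_assoc]; exact hx _ _)

theorem mem_overIdeal {M : Ideal B} {x : A} :
    x ∈ j.overIdeal M ↔ ∀ r s, j.compress (r * x * s) ∈ M :=
  TwoSidedIdeal.mem_mk' _ _ _ _ _ _ x

/-- The ideal over `M` contracts exactly to `M`: the compression of `r b s` is the product of the
compression of `r`, `b` and the compression of `s`. -/
theorem map_mem_overIdeal {M : Ideal B} {b : B} : j.toLinearMap b ∈ j.overIdeal M ↔ b ∈ M := by
  rw [mem_overIdeal]
  refine ⟨fun h => ?_, fun h r s => ?_⟩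
  · have := h (j.toLinearMap 1) (j.toLinearMap 1)
    rwa [one_mul, mul_one, compress_map] at this
  · rw [← j.mul_one b, ← mul_assoc, compress_mul_one_mul, compress_mul_map]
    exact M.mul_mem_right _ (M.mul_mem_left _ h)

/-- The pullback to `L` of the ideal lying over a prime ideal of a corner of `L / P` is prime. -/
theorem comap_overIdeal_isPrime {L : Type v} [NonUnitalRing L] (π : L → A)
    (hπ : Function.Surjective π)
    (hmul : ∀ x y, π (x * y) = π x * π y) (M : Ideal B) [hM : M.IsPrime]
    (Q : TwoSidedIdeal L) (hQ : ∀ x, x ∈ Q ↔ π x ∈ j.overIdeal M) : Q.IsPrime where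
  ne_top h := by
    obtain ⟨y, hy⟩ := hπ (j.toLinearMap 1)
    have : y ∈ Q := h ▸ trivial
    rw [hQ, hy, map_mem_overIdeal] at this
    exact hM.ne_top ((Ideal.eq_top_iff_one _).2 this)
  le_or_le I J h := by
    by_contra! hIJ
    obtain ⟨hI, hJ⟩ := hIJ
    obtain ⟨x, hx, hxQ⟩ := Set.not_subset.1 hI
    obtain ⟨y, hy, hyQ⟩ := Set.not_subset.1 hJ
    rw [SetLike.mem_coe, hQ, mem_overIdeal] at hxQ hyQ
    push Not at hxQ hyQ
    obtain ⟨r, s, hrs⟩ := hxQ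
    obtain ⟨r', s', hrs'⟩ := hyQ
    refine (hM.mem_or_mem (x := j.compress (r * π x * s)) (y := j.compress (r' * π y * s'))
      ?_).elim hrs hrs'
    -- The lift `t` of `s q r'` makes the product of the two compressions the compression of a
    -- single element, `r (x t y) s'`.
    obtain ⟨t, ht⟩ := hπ (s * j.toLinearMap 1 * r')
    have := h _ (I.mul_mem_right x t hx) y hy
    rw [hQ, hmul, hmul, mem_overIdeal, ht] at this
    rw [← compress_mul_one_mul]
    convert this r s' using 2
    simp only [mul_assoc]

/-- The ring `B` is a field, algebraic over `K`, as soon as the nonzero prime ideals lying over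
its maximal ideals have a common nonzero element. -/
theorem isField (j : CommCorner K A B) [IsPrimeRing A] [Nontrivial B] [Algebra.FiniteType K B]
    {a : A} (ha : a ≠ 0)
    (h : ∀ M : Ideal B, M.IsMaximal → M ≠ ⊥ → a ∈ j.overIdeal M) : IsField B := by
  have := j.isDomain
  have : IsJacobsonRing B := isJacobsonRing_of_finiteType (A := K)
  obtain ⟨r, s, hrs⟩ := j.exists_compress_ne_zero ha
  by_contra hB
  apply hrs
  -- A domain that is a Jacobson ring has zero Jacobson radical. If it is not a field, its maximal
  -- ideals are all nonzero, so by hypothesis each contains the nonzero compression of `a`.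
  have h1 : (⊥ : Ideal B).jacobson = ⊥ := by
    rw [← Ideal.radical_eq_jacobson]
    exact Ideal.isRadical_bot.radical
  rw [← Ideal.mem_bot, ← h1, Ideal.jacobson, Ideal.mem_sInf]
  rintro M ⟨-, hM⟩
  exact j.mem_overIdeal.1 (h M hM (Ring.ne_bot_of_isMaximal_of_not_isField hM hB)) r s

/-- Zariski's lemma. -/
theorem _root_.IsField.isAlgebraic_of_finiteType [Algebra.FiniteType K B] (h : IsField B) :
    Algebra.IsAlgebraic K B := by
  let : Field B := h.toField
  have : Module.Finite K B := finite_of_finite_type_of_isJacobsonRing K B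
  exact Algebra.IsAlgebraic.of_finite K B

open MartindaleQuotient

variable [IsScalarTower K A A] [SMulCommClass K A A] [IsPrimeRing A]

/-- Since `b = qb`, the equation `zq = b` iterates to `zⁿq = bⁿ`; centrality of `z` is not involved.
-/
theorem aeval_mul_of {z : MartindaleQuotient A} {b : B}
    (hb : z * of (j.toLinearMap 1) = of (j.toLinearMap b))
    (p : Polynomial K) :
    Polynomial.aeval z p * of (j.toLinearMap 1) = of (j.toLinearMap (Polynomial.aeval b p)) := by
  induction p using Polynomial.induction_on' with
  | add p q hp hq => rw [map_add, map_add, map_add, of_add, add_mul, hp, hq]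
  | monomial n k =>
    have hpow : z ^ n * of (j.toLinearMap 1) = of (j.toLinearMap (b ^ n)) := by
      induction n with
      | zero => rw [pow_zero, pow_zero, _root_.one_mul]
      | succ n ih =>
        rw [pow_succ, mul_assoc, hb, ← j.one_mul b, of_mul, ← mul_assoc, ih, ← of_mul, ← j.map_mul,
          pow_succ]
    rw [Polynomial.aeval_monomial, Polynomial.aeval_monomial, mul_assoc, hpow, algebraMap_mul_of,
      ← map_smul, Algebra.smul_def]

/-- Nonzero elements of the corner are invertible there, so `q` lies in every nonzero ideal, in
particular in one that `z` maps into `A`. Centrality gives `zq = q(zq)q`, an element of the corner;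
if `p` kills it, then the central element `p(z)` kills `q` and hence vanishes. -/
theorem extendedCentroid_isAlgebraic (j : CommCorner K A B) [Nontrivial B] (h : IsField B)
    [Algebra.IsAlgebraic K B] :
    Algebra.IsAlgebraic K (extendedCentroid K A) where
  isAlgebraic z := by
    have hz : ∀ y, y * z.1 = z.1 * y := Subalgebra.mem_center_iff.1 z.2
    have h1 := j.map_one_ne_zero
    obtain ⟨I, hI, hI'⟩ := exists_ideal z.1
    obtain ⟨d, hd, hd0⟩ : ∃ d ∈ I, d ≠ 0 := by
      by_contra! h0
      exact hI (le_bot_iff.mp fun d hd => (TwoSidedIdeal.mem_bot _).2 (h0 d hd))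
    obtain ⟨r, s, hrs⟩ := j.exists_compress_ne_zero hd0
    obtain ⟨c, hc⟩ := h.mul_inv_cancel hrs
    have hq : j.toLinearMap 1 ∈ I := by
      rw [← hc, j.map_mul, compress_spec]
      exact I.mul_mem_right _ _ (I.mul_mem_right _ _ (I.mul_mem_left _ _ (I.mul_mem_right _ _
        (I.mul_mem_left _ _ hd))))
    obtain ⟨a, ha⟩ := hI' _ hq
    have hb : z.1 * of (j.toLinearMap 1) = of (j.toLinearMap (j.compress a)) := by
      rw [compress_spec, of_mul, of_mul, ← ha, ← mul_assoc, hz, mul_assoc, mul_assoc,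
        ← of_mul, ← of_mul, j.one_mul, j.one_mul]
    obtain ⟨p, hp0, hp⟩ := Algebra.IsAlgebraic.isAlgebraic (R := K) (j.compress a)
    refine ⟨p, hp0, Subtype.ext ?_⟩
    rw [ZeroMemClass.coe_zero, Polynomial.aeval_subalgebra_coe]
    refine eq_zero_of_central_mul_of (fun y => ?_) h1
      (by rw [j.aeval_mul_of hb, hp, map_zero, of_zero])
    rw [← Polynomial.aeval_subalgebra_coe]
    exact Subalgebra.mem_center_iff.1 (Polynomial.aeval z p).2 y

end CommCorner

/-- The preimage in `L` of an ideal of `L / P`. -/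
def TwoSidedIdeal.comapQuotient {L : Type v} [NonUnitalRing L] (P : TwoSidedIdeal L)
    (I : TwoSidedIdeal P.ringCon.Quotient) : TwoSidedIdeal L :=
  TwoSidedIdeal.mk' {x : L | (x : P.ringCon.Quotient) ∈ I}
    I.zero_mem (fun hx hy => I.add_mem hx hy) (fun hx => I.neg_mem hx)
    (fun {x y} hy => I.mul_mem_left (x : P.ringCon.Quotient) (y : P.ringCon.Quotient) hy)
    (fun {x y} hx => I.mul_mem_right (x : P.ringCon.Quotient) (y : P.ringCon.Quotient) hx)

theorem TwoSidedIdeal.mem_comapQuotient {L : Type v} [NonUnitalRing L] {P : TwoSidedIdeal L}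
    {I : TwoSidedIdeal P.ringCon.Quotient} {x : L} :
    x ∈ P.comapQuotient I ↔ (x : P.ringCon.Quotient) ∈ I :=
  TwoSidedIdeal.mem_mk' _ _ _ _ _ _ x

/-- If some corner of `L / P` is a commutative algebra of finite type and `P` is locally closed,
then `P` is rational. -/
theorem TwoSidedIdeal.isRational_of_commCorner {K : Type u} [Field K] {L : Type v}
    [NonUnitalRing L] [Module K L] [IsScalarTower K L L] [SMulCommClass K L L]
    (P : TwoSidedIdeal L) [hP : P.IsPrime]
    (hlc : P.IsLocallyClosed) {B : Type w} [CommRing B] [Algebra K B] [Nontrivial B]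
    [Algebra.FiniteType K B] (j : CommCorner K P.ringCon.Quotient B) : P.IsRational K := by
  have key : ∀ x : L, (x : P.ringCon.Quotient) = 0 ↔ x ∈ P := fun x => by
    rw [← RingCon.coe_zero, RingCon.eq, P.mem_iff]
  -- Local closedness supplies the common nonzero element required by `CommCorner.isField`.
  obtain ⟨x, hx, hxP⟩ : ∃ x ∈ sInf {Q : TwoSidedIdeal L | Q.IsPrime ∧ P < Q}, x ∉ P := by
    by_contra! h
    exact hlc (le_antisymm (le_sInf fun Q hQ => hQ.2.le) h)
  have hF : IsField B := by
    refine j.isField (a := (x : P.ringCon.Quotient)) (fun h => hxP ((key x).1 h)) fun M hM hM0 => ?_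
    have hQ : ∀ x, x ∈ P.comapQuotient (j.overIdeal M) ↔ (x : P.ringCon.Quotient) ∈ j.overIdeal M :=
      fun x => TwoSidedIdeal.mem_comapQuotient
    generalize P.comapQuotient (j.overIdeal M) = Q at hQ
    have : M.IsPrime := hM.isPrime
    have hπ : Function.Surjective ((↑) : L → P.ringCon.Quotient) := Quotient.mk''_surjective
    have hQp : Q.IsPrime := j.comap_overIdeal_isPrime (↑) hπ (fun _ _ => rfl) M Q hQ
    refine (hQ x).1 ((TwoSidedIdeal.mem_sInf _).1 hx Q ⟨hQp, lt_of_le_not_ge ?_ fun hle => ?_⟩)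
    · intro y hy
      rw [hQ, (key y).2 hy]
      exact (j.overIdeal M).zero_mem
    -- The inclusion `P ≤ Q` is strict because a lift of a nonzero `b ∈ M` lies in `Q` but not in
    -- `P`.
    · obtain ⟨b, hb, hb0⟩ := Submodule.exists_mem_ne_zero_of_ne_bot hM0
      obtain ⟨y, hy⟩ := hπ (j.toLinearMap b)
      refine hb0 (j.injective ?_)
      rw [map_zero, ← hy]
      refine (key y).2 (hle ((hQ y).2 ?_))
      rw [hy]
      exact j.map_mem_overIdeal.2 hb
  have := hF.isAlgebraic_of_finiteType (K := K)
  exact j.extendedCentroid_isAlgebraic hF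

/-! ### Graph families in a ring, paths and their products -/

/-- A family of elements of `A` indexed by the vertices, edges and ghost edges of `E`, generating
`A` and satisfying the relations of a Leavitt path algebra other than `v = ∑ e e*`. -/
structure CohnFamily (K : Type u) [Field K] (E : DirectedGraph.{v, w}) (A : Type*)
    [NonUnitalRing A] [Module K A] where
  vert : E.Vertex → A
  edge : E.Edge → A
  ghost : E.Edge → A
  vert_mul_self : ∀ a, vert a * vert a = vert a
  vert_mul_vert : ∀ a b, a ≠ b → vert a * vert b = 0
  src_edge : ∀ e, vert (E.src e) * edge e = edge e
  edge_rng : ∀ e, edge e * vert (E.rng e) = edge e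
  rng_ghost : ∀ e, vert (E.rng e) * ghost e = ghost e
  ghost_src : ∀ e, ghost e * vert (E.src e) = ghost e
  ghost_mul_edge : ∀ e, ghost e * edge e = vert (E.rng e)
  ghost_mul_edge_of_ne : ∀ e f, e ≠ f → ghost e * edge f = 0
  eq_top : ∀ S : Submodule K A, (∀ a, vert a ∈ S) → (∀ e, edge e ∈ S) → (∀ e, ghost e ∈ S) →
    (∀ a, ∀ s ∈ S, vert a * s ∈ S) → (∀ e, ∀ s ∈ S, edge e * s ∈ S) →
    (∀ e, ∀ s ∈ S, ghost e * s ∈ S) → S = ⊤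

namespace DirectedGraph

variable (E : DirectedGraph.{v, w})

/-- `E.Walk a l x` says that the edges in `l` form a path from `a` to `x`. -/
def Walk : E.Vertex → List E.Edge → E.Vertex → Prop
  | a, [], x => a = x
  | a, e :: l, x => E.src e = a ∧ Walk (E.rng e) l x

/-- The first vertex of a list of edges that ends at `x`. -/
def start : List E.Edge → E.Vertex → E.Vertex
  | [], x => x
  | e :: _, _ => E.src e

variable {E}

theorem Walk.start_eq {a x : E.Vertex} {l : List E.Edge} (h : E.Walk a l x) : E.start l x = a := by
  cases l with
  | nil => exact h.symm
  | cons e l => exact h.1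

theorem Walk.append {a b c : E.Vertex} {l m : List E.Edge} (h : E.Walk a l b) (h' : E.Walk b m c) :
    E.Walk a (l ++ m) c := by
  induction l generalizing a with
  | nil => cases h; exact h'
  | cons e l ih => exact ⟨h.1, ih h.2⟩

theorem Walk.of_append {a c : E.Vertex} {l m : List E.Edge} (h : E.Walk a (l ++ m) c) :
    E.Walk a l (E.start m c) ∧ E.Walk (E.start m c) m c := by
  induction l generalizing a with
  | nil =>
    have h' : E.Walk a m c := h
    rw [h'.start_eq]
    exact ⟨rfl, h'⟩
  | cons e l ih => exact ⟨⟨h.1, (ih h.2).1⟩, (ih h.2).2⟩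

theorem Walk.eq_of_walk {a b c : E.Vertex} {l : List E.Edge} (h : E.Walk a l b)
    (h' : E.Walk a l c) : b = c := by
  induction l generalizing a with
  | nil => exact h.symm.trans h'
  | cons e l ih => exact ih h.2 h'.2

/-- No two positions up to `N` start the same word in `q`. -/
def Aperiodic (N : ℕ) (q : List E.Edge) : Prop :=
  N ≤ q.length ∧ ∀ a b, a < b → b ≤ N → ∃ i, ∃ h : b + i < q.length, q[a + i]? ≠ some q[b + i]

theorem Aperiodic.mono {N N' : ℕ} {q : List E.Edge} (h : Aperiodic N q) (hN : N' ≤ N) :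
    Aperiodic N' q :=
  ⟨hN.trans h.1, fun a b hab hb => h.2 a b hab (hb.trans hN)⟩

end DirectedGraph

namespace CohnFamily

open DirectedGraph

variable {K : Type u} [Field K] {E : DirectedGraph.{v, w}} {A : Type*} [NonUnitalRing A]
  [Module K A] (F : CohnFamily K E A)

/-- The product of the edges in a list, followed by a vertex. -/
def path : List E.Edge → E.Vertex → A
  | [], x => F.vert x
  | e :: l, x => F.edge e * path l x

/-- The product of the ghosts of the edges in a list in reverse order, preceded by a vertex. -/
def ghostPath : List E.Edge → E.Vertex → A
  | [], x => F.vert x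
  | e :: l, x => ghostPath l x * F.ghost e

theorem path_mul_vert (l : List E.Edge) (x : E.Vertex) : F.path l x * F.vert x = F.path l x := by
  induction l with
  | nil => exact F.vert_mul_self x
  | cons e l ih => rw [path, mul_assoc, ih]

theorem vert_mul_ghostPath (l : List E.Edge) (x : E.Vertex) :
    F.vert x * F.ghostPath l x = F.ghostPath l x := by
  induction l with
  | nil => exact F.vert_mul_self x
  | cons e l ih => rw [ghostPath, ← mul_assoc, ih]

theorem path_mul_vert_of_ne (l : List E.Edge) {x y : E.Vertex} (h : x ≠ y) :
    F.path l x * F.vert y = 0 := by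
  rw [← path_mul_vert, mul_assoc, F.vert_mul_vert _ _ h, mul_zero]

theorem vert_mul_ghostPath_of_ne (l : List E.Edge) {x y : E.Vertex} (h : y ≠ x) :
    F.vert y * F.ghostPath l x = 0 := by
  rw [← vert_mul_ghostPath, ← mul_assoc, F.vert_mul_vert _ _ h, zero_mul]

theorem vert_start_mul_path (l : List E.Edge) (x : E.Vertex) :
    F.vert (E.start l x) * F.path l x = F.path l x := by
  cases l with
  | nil => exact F.vert_mul_self x
  | cons e l => rw [path, start, ← mul_assoc, F.src_edge]

theorem ghostPath_mul_vert_start (l : List E.Edge) (x : E.Vertex) :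
    F.ghostPath l x * F.vert (E.start l x) = F.ghostPath l x := by
  cases l with
  | nil => exact F.vert_mul_self x
  | cons e l => rw [ghostPath, start, mul_assoc, F.ghost_src]

theorem vert_mul_path_of_ne {l : List E.Edge} {a x : E.Vertex} (h : a ≠ E.start l x) :
    F.vert a * F.path l x = 0 := by
  rw [← vert_start_mul_path, ← mul_assoc, F.vert_mul_vert _ _ h, zero_mul]

theorem ghostPath_mul_vert_of_ne {l : List E.Edge} {a x : E.Vertex} (h : a ≠ E.start l x) :
    F.ghostPath l x * F.vert a = 0 := by
  rw [← ghostPath_mul_vert_start, mul_assoc, F.vert_mul_vert _ _ h.symm, mul_zero]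

theorem vert_mul_path {l : List E.Edge} {a x : E.Vertex} (h : E.Walk a l x) :
    F.vert a * F.path l x = F.path l x := by
  rw [← h.start_eq, vert_start_mul_path]

theorem ghostPath_mul_vert {l : List E.Edge} {a x : E.Vertex} (h : E.Walk a l x) :
    F.ghostPath l x * F.vert a = F.ghostPath l x := by
  rw [← h.start_eq, ghostPath_mul_vert_start]

theorem path_append (l m : List E.Edge) (x : E.Vertex) :
    F.path (l ++ m) x = F.path l (E.start m x) * F.path m x := by
  induction l with
  | nil => exact (F.vert_start_mul_path m x).symm
  | cons e l ih => rw [List.cons_append, path, ih, path, mul_assoc]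

theorem ghostPath_append (l m : List E.Edge) (x : E.Vertex) :
    F.ghostPath (l ++ m) x = F.ghostPath m x * F.ghostPath l (E.start m x) := by
  induction l with
  | nil => exact (F.ghostPath_mul_vert_start m x).symm
  | cons e l ih => rw [List.cons_append, ghostPath, ih, ghostPath, mul_assoc]

theorem path_eq_zero {l : List E.Edge} {x : E.Vertex} (h : ¬ E.Walk (E.start l x) l x) :
    F.path l x = 0 := by
  induction l with
  | nil => exact absurd rfl h
  | cons e l ih =>
    by_cases he : E.rng e = E.start l x
    · rw [path, ih fun h' => h ⟨rfl, he ▸ h'⟩, mul_zero]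
    · rw [path, ← F.edge_rng, mul_assoc, F.vert_mul_path_of_ne he, mul_zero]

theorem ghostPath_eq_zero {l : List E.Edge} {x : E.Vertex} (h : ¬ E.Walk (E.start l x) l x) :
    F.ghostPath l x = 0 := by
  induction l with
  | nil => exact absurd rfl h
  | cons e l ih =>
    by_cases he : E.rng e = E.start l x
    · rw [ghostPath, ih fun h' => h ⟨rfl, he ▸ h'⟩, zero_mul]
    · rw [ghostPath, ← F.rng_ghost, ← mul_assoc, F.ghostPath_mul_vert_of_ne he, zero_mul]

theorem ghostPath_mul_path {l : List E.Edge} {a x : E.Vertex} (h : E.Walk a l x) :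
    F.ghostPath l x * F.path l x = F.vert x := by
  induction l generalizing a with
  | nil => exact F.vert_mul_self x
  | cons e l ih =>
    rw [path, ghostPath, mul_assoc, ← mul_assoc (F.ghost e), F.ghost_mul_edge,
      F.vert_mul_path h.2, ih h.2]

/-- For a path `p` from `a` to `x` one has `x = p* a p`, so survival of vertices propagates
backwards along paths. -/
theorem vert_ne_zero_of_walk {l : List E.Edge} {a x : E.Vertex} (h : E.Walk a l x)
    (hx : F.vert x ≠ 0) : F.vert a ≠ 0 := fun h' => hx <| by
  rw [← F.ghostPath_mul_path h, ← F.vert_mul_path h, h', zero_mul, mul_zero]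

theorem edge_eq_zero {e : E.Edge} (h : F.vert (E.rng e) = 0) : F.edge e = 0 := by
  rw [← F.edge_rng, h, mul_zero]

/-- The relations `e*f = 0` and `e*e = r(e)` compare the two words letter by letter from the front:
a mismatch gives zero, a common prefix cancels. -/
theorem ghostPath_mul_path_of_length_le (l q : List E.Edge) (x u : E.Vertex)
    (h : l.length ≤ q.length) :
    F.ghostPath q u * F.path l x = 0 ∨
      ∃ s, q = l ++ s ∧ F.ghostPath q u * F.path l x = F.ghostPath s u := by
  induction l generalizing q with
  | nil =>
    by_cases hx : x = E.start q u
    · exact Or.inr ⟨q, rfl, by rw [path, hx, ghostPath_mul_vert_start]⟩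
    · exact Or.inl (F.ghostPath_mul_vert_of_ne hx)
  | cons e l ih =>
    obtain _ | ⟨f, q⟩ := q
    · simp at h
    rw [path, ghostPath, mul_assoc, ← mul_assoc (F.ghost f)]
    by_cases hef : f = e
    · subst hef
      rw [F.ghost_mul_edge]
      by_cases hr : E.rng f = E.start l x
      · rw [hr, vert_start_mul_path]
        refine (ih q (by simpa using h)).imp_right ?_
        rintro ⟨s, rfl, hs⟩
        exact ⟨s, rfl, hs⟩
      · rw [F.vert_mul_path_of_ne hr, mul_zero]
        exact Or.inl rfl
    · rw [F.ghost_mul_edge_of_ne _ _ hef, zero_mul, mul_zero]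
      exact Or.inl rfl

theorem ghostPath_mul_path_of_le_length (l q : List E.Edge) (x u : E.Vertex)
    (h : l.length ≤ q.length) :
    F.ghostPath l x * F.path q u = 0 ∨
      ∃ s, q = l ++ s ∧ F.ghostPath l x * F.path q u = F.path s u := by
  induction l generalizing q with
  | nil =>
    by_cases hx : x = E.start q u
    · exact Or.inr ⟨q, rfl, by rw [ghostPath, hx, vert_start_mul_path]⟩
    · exact Or.inl (F.vert_mul_path_of_ne hx)
  | cons e l ih =>
    obtain _ | ⟨f, q⟩ := q
    · simp at h
    rw [path, ghostPath, mul_assoc, ← mul_assoc (F.ghost e)]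
    by_cases hef : e = f
    · subst hef
      rw [F.ghost_mul_edge, ← mul_assoc]
      by_cases hr : E.rng e = E.start l x
      · rw [hr, ghostPath_mul_vert_start]
        refine (ih q (by simpa using h)).imp_right ?_
        rintro ⟨s, rfl, hs⟩
        exact ⟨s, rfl, hs⟩
      · rw [F.ghostPath_mul_vert_of_ne hr, zero_mul]
        exact Or.inl rfl
    · rw [F.ghost_mul_edge_of_ne _ _ hef, zero_mul, mul_zero]
      exact Or.inl rfl

theorem ghostPath_mul_path_of_getElem_ne (s t : List E.Edge) (x y : E.Vertex) (i : ℕ)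
    (hs : i < s.length) (ht : i < t.length) (h : s[i] ≠ t[i]) :
    F.ghostPath s x * F.path t y = 0 := by
  induction s generalizing t i with
  | nil => simp at hs
  | cons e s ih =>
    obtain _ | ⟨f, t⟩ := t
    · simp at ht
    rw [path, ghostPath, mul_assoc, ← mul_assoc (F.ghost e)]
    by_cases hef : e = f
    · subst hef
      obtain _ | i := i
      · simp at h
      rw [F.ghost_mul_edge]
      by_cases hr : E.rng e = E.start t y
      · rw [hr, vert_start_mul_path]
        exact ih t i (by simpa using hs) (by simpa using ht) (by simpa using h)
      · rw [F.vert_mul_path_of_ne hr, mul_zero]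
    · rw [F.ghost_mul_edge_of_ne _ _ hef, zero_mul, mul_zero]

/-- Conjugating a monomial by an aperiodic path gives zero or a vertex. -/
theorem conj_aperiodic {N : ℕ} {q : List E.Edge} (hq : Aperiodic N q) {a u : E.Vertex}
    (hw : E.Walk a q u) (l m : List E.Edge) (x : E.Vertex) (hl : l.length ≤ N) (hm : m.length ≤ N) :
    F.ghostPath q u * (F.path l x * F.ghostPath m x) * F.path q u = 0 ∨
      l = m ∧ F.ghostPath q u * (F.path l x * F.ghostPath m x) * F.path q u = F.vert u := by
  rw [← mul_assoc, mul_assoc]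
  rcases F.ghostPath_mul_path_of_length_le l q x u (hl.trans hq.1) with h | ⟨s, rfl, hs⟩
  · rw [h, zero_mul]; exact Or.inl rfl
  rcases F.ghostPath_mul_path_of_le_length m (l ++ s) x u (hm.trans hq.1) with h | ⟨t, ht, ht'⟩
  · rw [h, mul_zero]; exact Or.inl rfl
  rw [hs, ht']
  have hs' : ∀ i, (l ++ s)[l.length + i]? = s[i]? := fun i => by
    rw [List.getElem?_append_right (by omega)]; congr 1; omega
  have ht' : ∀ i, (l ++ s)[m.length + i]? = t[i]? := fun i => by
    rw [ht, List.getElem?_append_right (by omega)]; congr 1; omega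
  have hlen : l.length + s.length = m.length + t.length := by
    rw [← List.length_append, ht, List.length_append]
  -- Here `q = ls = mt` and the product has become `s* t`. If `l` and `m` have different lengths,
  -- `s` and `t` are the tails of `q` at two distinct positions up to `N`, and aperiodicity provides
  -- a mismatch between them.
  rcases lt_trichotomy l.length m.length with h | h | h
  · obtain ⟨i, hi, hne⟩ := hq.2 _ _ h hm
    rw [← List.getElem?_eq_getElem hi, hs', ht'] at hne
    have h1 : i < t.length := by rw [List.length_append] at hi; omega
    have h2 : i < s.length := by omega
    refine Or.inl (F.ghostPath_mul_path_of_getElem_ne s t u u i h2 h1 fun h => hne ?_)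
    rw [List.getElem?_eq_getElem h1, List.getElem?_eq_getElem h2, h]
  · obtain ⟨rfl, rfl⟩ := List.append_inj ht h
    exact Or.inr ⟨rfl, F.ghostPath_mul_path hw.of_append.2⟩
  · obtain ⟨i, hi, hne⟩ := hq.2 _ _ h hl
    rw [← List.getElem?_eq_getElem hi, hs', ht'] at hne
    have h1 : i < s.length := by rw [List.length_append] at hi; omega
    have h2 : i < t.length := by omega
    refine Or.inl (F.ghostPath_mul_path_of_getElem_ne s t u u i h1 h2 fun h => hne ?_)
    rw [List.getElem?_eq_getElem h1, List.getElem?_eq_getElem h2, h]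

end CohnFamily

/-! ### Monomial spans and the reduction of ideals to vertices -/

set_option linter.unusedSectionVars false

namespace CohnFamily

open DirectedGraph

variable {K : Type u} [Field K] {E : DirectedGraph.{v, w}} {A : Type*} [NonUnitalRing A]
  [Module K A] (F : CohnFamily K E A)

theorem mul_mem_of_forall_mul_mem [SMulCommClass K A A] {X : Set A} {S : Submodule K A} {t a : A}
    (ha : a ∈ Submodule.span K X) (h : ∀ x ∈ X, t * x ∈ S) : t * a ∈ S := by
  induction ha using Submodule.span_induction with
  | mem x hx => exact h x hx
  | zero => rw [mul_zero]; exact S.zero_mem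
  | add x y _ _ hx hy => rw [mul_add]; exact S.add_mem hx hy
  | smul k x _ hx => rw [mul_smul_comm]; exact S.smul_mem k hx

theorem mul_mem_of_forall_mem_mul [IsScalarTower K A A] {X : Set A} {S : Submodule K A} {t a : A}
    (ha : a ∈ Submodule.span K X) (h : ∀ x ∈ X, x * t ∈ S) : a * t ∈ S := by
  induction ha using Submodule.span_induction with
  | mem x hx => exact h x hx
  | zero => rw [zero_mul]; exact S.zero_mem
  | add x y _ _ hx hy => rw [add_mul]; exact S.add_mem hx hy
  | smul k x _ hx => rw [smul_mul_assoc]; exact S.smul_mem k hx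

/-- The span of the monomials with at most `n` ghost edges. -/
def ghostSpan (n : ℕ) : Submodule K A :=
  Submodule.span K {a | ∃ l m x, m.length ≤ n ∧ a = F.path l x * F.ghostPath m x}

/-- The span of the paths of length at most `n`. -/
def pathSpan (n : ℕ) : Submodule K A :=
  Submodule.span K {a | ∃ l x, l.length ≤ n ∧ a = F.path l x}

/-- The span of the paths of positive length at most `n`. -/
def posPathSpan (n : ℕ) : Submodule K A :=
  Submodule.span K {a | ∃ l x, l ≠ [] ∧ l.length ≤ n ∧ a = F.path l x}

theorem path_mul_ghostPath_nil (l : List E.Edge) (x : E.Vertex) :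
    F.path l x * F.ghostPath [] x = F.path l x := F.path_mul_vert l x

/-- Left multiplication by a generator sends a monomial `l m*` to a monomial or to zero. The
delicate case is a ghost edge: it cancels against the first edge of `l`, or extends `m` when `l` is
empty. -/
theorem span_monomials [SMulCommClass K A A] :
    Submodule.span K {a | ∃ l m x, a = F.path l x * F.ghostPath m x} = ⊤ := by
  apply F.eq_top
  · exact fun a => Submodule.subset_span ⟨[], [], a, (F.vert_mul_self a).symm⟩
  · refine fun e => Submodule.subset_span ⟨[e], [], E.rng e, ?_⟩
    rw [path_mul_ghostPath_nil, path, path, F.edge_rng]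
  · refine fun e => Submodule.subset_span ⟨[], [e], E.rng e, ?_⟩
    rw [path, vert_mul_ghostPath, ghostPath, ghostPath, F.rng_ghost]
  · intro a s hs
    refine mul_mem_of_forall_mul_mem hs ?_
    rintro _ ⟨l, m, x, rfl⟩
    rw [← mul_assoc]
    by_cases h : a = E.start l x
    · rw [h, vert_start_mul_path]
      exact Submodule.subset_span ⟨l, m, x, rfl⟩
    · rw [F.vert_mul_path_of_ne h, zero_mul]
      exact Submodule.zero_mem _
  · intro e s hs
    refine mul_mem_of_forall_mul_mem hs ?_
    rintro _ ⟨l, m, x, rfl⟩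
    exact Submodule.subset_span ⟨e :: l, m, x, (mul_assoc _ _ _).symm⟩
  · intro e s hs
    refine mul_mem_of_forall_mul_mem hs ?_
    rintro _ ⟨l, m, x, rfl⟩
    obtain _ | ⟨f, l⟩ := l
    · by_cases h : E.src e = x
      · subst h
        refine Submodule.subset_span ⟨[], m ++ [e], E.rng e, ?_⟩
        rw [ghostPath_append, path, vert_mul_ghostPath, path, ghostPath, ghostPath, start,
          F.rng_ghost, ← mul_assoc, F.rng_ghost]
      · rw [path, vert_mul_ghostPath, ← F.ghost_src, mul_assoc, F.vert_mul_ghostPath_of_ne _ h,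
          mul_zero]
        exact Submodule.zero_mem _
    · rw [path, ← mul_assoc, ← mul_assoc]
      by_cases h : e = f
      · subst h
        rw [F.ghost_mul_edge]
        by_cases h : E.rng e = E.start l x
        · rw [h, vert_start_mul_path]
          exact Submodule.subset_span ⟨l, m, x, rfl⟩
        · rw [F.vert_mul_path_of_ne h, zero_mul]
          exact Submodule.zero_mem _
      · rw [F.ghost_mul_edge_of_ne _ _ h, zero_mul, zero_mul]
        exact Submodule.zero_mem _

theorem mem_span_monomials [SMulCommClass K A A] (a : A) :
    a ∈ Submodule.span K {a | ∃ l m x, a = F.path l x * F.ghostPath m x} := by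
  rw [span_monomials]; trivial

theorem exists_mem_ghostSpan [SMulCommClass K A A] (a : A) : ∃ n, a ∈ F.ghostSpan n := by
  induction F.mem_span_monomials a using Submodule.span_induction with
  | mem x hx =>
    obtain ⟨l, m, x, rfl⟩ := hx
    exact ⟨m.length, Submodule.subset_span ⟨l, m, x, le_rfl, rfl⟩⟩
  | zero => exact ⟨0, Submodule.zero_mem _⟩
  | add x y _ _ hx hy =>
    obtain ⟨n, hn⟩ := hx
    obtain ⟨n', hn'⟩ := hy
    refine ⟨max n n', Submodule.add_mem _ (Submodule.span_mono ?_ hn) (Submodule.span_mono ?_ hn')⟩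
    · rintro _ ⟨l, m, x, hm, rfl⟩
      exact ⟨l, m, x, hm.trans (le_max_left _ _), rfl⟩
    · rintro _ ⟨l, m, x, hm, rfl⟩
      exact ⟨l, m, x, hm.trans (le_max_right _ _), rfl⟩
  | smul k x _ hx =>
    obtain ⟨n, hn⟩ := hx
    exact ⟨n, Submodule.smul_mem _ k hn⟩

theorem pathSpan_mono {m n : ℕ} (h : m ≤ n) : F.pathSpan m ≤ F.pathSpan n := by
  refine Submodule.span_mono ?_
  rintro _ ⟨l, x, hl, rfl⟩
  exact ⟨l, x, hl.trans h, rfl⟩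

variable [IsScalarTower K A A] [SMulCommClass K A A]

/-- Every monomial is fixed on the left by its starting vertex, so vertices serve as local units in
the absence of an identity. -/
theorem mul_eq_zero_of_forall_mul_vert {a : A} (h : ∀ x, a * F.vert x = 0) (b : A) : a * b = 0 := by
  have : a * b ∈ (⊥ : Submodule K A) := by
    refine mul_mem_of_forall_mul_mem (F.mem_span_monomials b) ?_
    rintro _ ⟨l, m, x, rfl⟩
    rw [← vert_start_mul_path, ← mul_assoc, ← mul_assoc, h, zero_mul, zero_mul]
    exact Submodule.zero_mem _
  exact this

theorem exists_mul_vert_ne_zero [IsPrimeRing A] {a : A} (ha : a ≠ 0) : ∃ x, a * F.vert x ≠ 0 := by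
  by_contra! h
  exact ha (IsPrimeRing.eq_zero_of_mul IsPrimeRing.top_ne_bot
    fun b _ => F.mul_eq_zero_of_forall_mul_vert h b)

theorem mul_vert_eq_smul_add {n : ℕ} {b : A} (hb : b ∈ F.pathSpan n) (x : E.Vertex) :
    ∃ k : K, ∃ r ∈ F.posPathSpan n, b * F.vert x = k • F.vert x + r := by
  induction hb using Submodule.span_induction with
  | mem b hb =>
    obtain ⟨l, y, hl, rfl⟩ := hb
    by_cases hxy : y = x
    · subst hxy
      obtain _ | ⟨e, l⟩ := l
      · exact ⟨1, 0, Submodule.zero_mem _, by rw [path_mul_vert, one_smul, add_zero, path]⟩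
      · exact ⟨0, _, Submodule.subset_span ⟨e :: l, y, List.cons_ne_nil _ _, hl, rfl⟩,
          by rw [path_mul_vert, zero_smul, zero_add]⟩
    · exact ⟨0, 0, Submodule.zero_mem _, by
        rw [F.path_mul_vert_of_ne _ hxy, zero_smul, zero_add]⟩
  | zero => exact ⟨0, 0, Submodule.zero_mem _, by rw [zero_mul, zero_smul, zero_add]⟩
  | add b c _ _ hb hc =>
    obtain ⟨k, r, hr, h⟩ := hb
    obtain ⟨k', r', hr', h'⟩ := hc
    exact ⟨k + k', r + r', Submodule.add_mem _ hr hr', by rw [add_mul, h, h', add_smul]; abel⟩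
  | smul c b _ hb =>
    obtain ⟨k, r, hr, h⟩ := hb
    exact ⟨c * k, c • r, Submodule.smul_mem _ _ hr, by rw [smul_mul_assoc, h, smul_add, mul_smul]⟩

/-- `e e*` fixes paths beginning with `e` and kills all other paths of positive length; `G` collects
the first edges that occur. Allowing every larger finite set makes the property additive. -/
theorem exists_finset_eq_sum {n : ℕ} {r : A} (hr : r ∈ F.posPathSpan n) :
    ∃ G : Finset E.Edge, ∀ G', G ⊆ G' → r = ∑ e ∈ G', F.edge e * (F.ghost e * r) := by
  classical
  induction hr using Submodule.span_induction with
  | mem b hb =>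
    obtain ⟨l, y, hl, -, rfl⟩ := hb
    obtain _ | ⟨e, l⟩ := l
    · exact absurd rfl hl
    refine ⟨{e}, fun G' hG => ?_⟩
    rw [Finset.sum_eq_single_of_mem e (hG (Finset.mem_singleton_self e))]
    · rw [path, ← mul_assoc (F.ghost e), F.ghost_mul_edge, ← mul_assoc, F.edge_rng]
    · intro f _ hf
      rw [path, ← mul_assoc (F.ghost f), F.ghost_mul_edge_of_ne _ _ hf, zero_mul, mul_zero]
  | zero => exact ⟨∅, fun G' _ => by simp⟩
  | add b c _ _ hb hc =>
    obtain ⟨G, h⟩ := hb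
    obtain ⟨G', h'⟩ := hc
    refine ⟨G ∪ G', fun H hH => ?_⟩
    conv_lhs => rw [h H (Finset.union_subset_left hH), h' H (Finset.union_subset_right hH)]
    simp only [mul_add, Finset.sum_add_distrib]
  | smul k b _ hb =>
    obtain ⟨G, h⟩ := hb
    refine ⟨G, fun H hH => ?_⟩
    conv_lhs => rw [h H hH]
    simp only [mul_smul_comm, Finset.smul_sum]

theorem ghost_mul_mem_pathSpan {n : ℕ} {r : A} (hr : r ∈ F.posPathSpan (n + 1)) (e : E.Edge) :
    F.ghost e * r ∈ F.pathSpan n := by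
  refine mul_mem_of_forall_mul_mem hr ?_
  rintro _ ⟨l, x, hl, hn, rfl⟩
  obtain _ | ⟨f, l⟩ := l
  · exact absurd rfl hl
  rw [path, ← mul_assoc]
  by_cases h : e = f
  · subst h
    rw [F.ghost_mul_edge]
    by_cases h : E.rng e = E.start l x
    · rw [h, vert_start_mul_path]
      exact Submodule.subset_span ⟨l, x, by simpa using hn, rfl⟩
    · rw [F.vert_mul_path_of_ne h]
      exact Submodule.zero_mem _
  · rw [F.ghost_mul_edge_of_ne _ _ h, zero_mul]
    exact Submodule.zero_mem _

theorem vert_mul_mem_posPathSpan {n : ℕ} {r : A} (hr : r ∈ F.posPathSpan n) (a : E.Vertex) :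
    F.vert a * r ∈ F.posPathSpan n := by
  refine mul_mem_of_forall_mul_mem hr ?_
  rintro _ ⟨l, x, hl, hn, rfl⟩
  by_cases h : a = E.start l x
  · rw [h, vert_start_mul_path]
    exact Submodule.subset_span ⟨l, x, hl, hn, rfl⟩
  · rw [F.vert_mul_path_of_ne h]
    exact Submodule.zero_mem _

/-- A combination of paths can be multiplied so as to have a nonzero constant term. -/
theorem exists_mul_eq_smul_add {n : ℕ} {b : A} (hb : b ∈ F.pathSpan n) {x : E.Vertex}
    (hx : b * F.vert x ≠ 0) :
    ∃ t : A, ∃ k : K, k ≠ 0 ∧ ∃ m, ∃ r ∈ F.posPathSpan m, t * b * F.vert x = k • F.vert x + r := by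
  induction n generalizing b with
  | zero =>
    obtain ⟨k, r, hr, h⟩ := F.mul_vert_eq_smul_add hb x
    have hr0 : r = 0 := by
      have : F.posPathSpan 0 ≤ ⊥ := Submodule.span_le.2 <| by
        rintro _ ⟨l, y, hl, hl', rfl⟩
        exact absurd (List.length_eq_zero_iff.1 (Nat.le_zero.1 hl')) hl
      exact this hr
    refine ⟨F.vert x, k, ?_, 0, 0, Submodule.zero_mem _, ?_⟩
    · rintro rfl
      rw [zero_smul, zero_add] at h
      exact hx (h.trans hr0)
    · rw [mul_assoc, h, hr0, add_zero, mul_smul_comm, F.vert_mul_self]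
  | succ n ih =>
    obtain ⟨k, r, hr, h⟩ := F.mul_vert_eq_smul_add hb x
    by_cases hk : k = 0
    · rw [hk, zero_smul, zero_add] at h
      obtain ⟨G, hG⟩ := F.exists_finset_eq_sum hr
      -- With no constant term, a ghost edge strips the first edge off every path and shortens the
      -- combination without killing it.
      obtain ⟨e, he⟩ : ∃ e, F.ghost e * r ≠ 0 := by
        by_contra! h0
        refine hx (h.trans ((hG G subset_rfl).trans (Finset.sum_eq_zero fun e _ => ?_)))
        rw [h0, mul_zero]
      have hrx : F.ghost e * r * F.vert x = F.ghost e * r := by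
        rw [mul_assoc, ← h, mul_assoc, F.vert_mul_self]
      obtain ⟨t, k, hk, m, r', hr', h'⟩ := ih (F.ghost_mul_mem_pathSpan hr e) (by rwa [hrx])
      refine ⟨t * F.ghost e, k, hk, m, r', hr', ?_⟩
      rw [← h', mul_assoc t (F.ghost e * r), hrx, ← h]
      simp only [mul_assoc]
    · refine ⟨F.vert x, k, hk, _, _, F.vert_mul_mem_posPathSpan hr x, ?_⟩
      rw [mul_assoc, h, mul_add, mul_smul_comm, F.vert_mul_self]

/-- Write `t b x = k x + r` with `k ≠ 0`. For an edge `e` at `x` outside the first edges of `r`,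
`e*(k x + r)e = k r(e)`, which is nonzero; hence `be ≠ 0`. -/
theorem exists_finset_mul_edge_ne_zero {n : ℕ} {b : A} (hb : b ∈ F.pathSpan n) {x : E.Vertex}
    (hx : b * F.vert x ≠ 0) :
    ∃ G : Finset E.Edge, ∀ e, e ∉ G → E.src e = x → F.vert (E.rng e) ≠ 0 → b * F.edge e ≠ 0 := by
  obtain ⟨t, k, hk, m, r, hr, h⟩ := F.exists_mul_eq_smul_add hb hx
  obtain ⟨G, hG⟩ := F.exists_finset_eq_sum hr
  refine ⟨G, ?_⟩
  rintro e he rfl hre hbe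
  have h1 : F.ghost e * r = 0 := by
    rw [hG G subset_rfl, Finset.mul_sum]
    refine Finset.sum_eq_zero fun f hf => ?_
    rw [← mul_assoc, F.ghost_mul_edge_of_ne e f (by rintro rfl; exact he hf), zero_mul]
  have h2 := congrArg (fun y => F.ghost e * (y * F.edge e)) h
  rw [mul_assoc (t * b), F.src_edge, mul_assoc t,
    hbe, mul_zero, mul_zero, add_mul, smul_mul_assoc,
    F.src_edge, mul_add, mul_smul_comm, F.ghost_mul_edge, ← mul_assoc, h1, zero_mul, add_zero] at h2
  exact (smul_ne_zero hk hre) h2.symm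

/-- Every nonzero vertex emits infinitely many nonzero edges, or is the sum of `e e*` over finitely
many edges `e` that it emits. -/
def IsLeavitt : Prop :=
  ∀ x, F.vert x ≠ 0 →
    (∀ G : Finset E.Edge, ∃ e ∉ G, E.src e = x ∧ F.vert (E.rng e) ≠ 0) ∨
    ∃ G : Finset E.Edge, (∀ e ∈ G, E.src e = x) ∧ F.vert x = ∑ e ∈ G, F.edge e * F.ghost e

/-- Right multiplication by `1 - ∑ e e*` kills every monomial ending in a ghost edge of the sum, so
only the pure path part `b` of `a` survives. -/
theorem exists_finset_sub_sum {n : ℕ} {a : A} (ha : a ∈ F.ghostSpan n) :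
    ∃ m, ∃ b ∈ F.pathSpan m, ∃ G : Finset E.Edge, ∀ G', G ⊆ G' →
      a - ∑ e ∈ G', a * F.edge e * F.ghost e = b - ∑ e ∈ G', b * F.edge e * F.ghost e := by
  classical
  induction ha using Submodule.span_induction with
  | mem a ha =>
    obtain ⟨l, m, x, -, rfl⟩ := ha
    obtain _ | ⟨f, m⟩ := m
    · refine ⟨l.length, F.path l x, Submodule.subset_span ⟨l, x, le_rfl, rfl⟩, ∅, fun G' _ => ?_⟩
      rw [path_mul_ghostPath_nil]
    · refine ⟨0, 0, Submodule.zero_mem _, {f}, fun G' hG => ?_⟩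
      rw [Finset.sum_eq_single_of_mem f (hG (Finset.mem_singleton_self f))]
      · rw [ghostPath]
        simp only [mul_assoc, zero_mul, Finset.sum_const_zero, sub_zero]
        rw [← mul_assoc (F.ghost f), F.ghost_mul_edge, F.rng_ghost, sub_self]
      · intro e _ he
        rw [ghostPath, ← mul_assoc, mul_assoc _ (F.ghost f), F.ghost_mul_edge_of_ne _ _ he.symm,
          mul_zero, zero_mul]
  | zero => exact ⟨0, 0, Submodule.zero_mem _, ∅, fun _ _ => rfl⟩
  | add a c _ _ ha hc =>
    obtain ⟨m, b, hb, G, h⟩ := ha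
    obtain ⟨m', b', hb', G', h'⟩ := hc
    refine ⟨max m m', b + b', Submodule.add_mem _ (F.pathSpan_mono (le_max_left _ _) hb)
      (F.pathSpan_mono (le_max_right _ _) hb'), G ∪ G', fun H hH => ?_⟩
    simp only [add_mul, Finset.sum_add_distrib, add_sub_add_comm]
    rw [h H (Finset.union_subset_left hH), h' H (Finset.union_subset_right hH)]
  | smul k a _ ha =>
    obtain ⟨m, b, hb, G, h⟩ := ha
    refine ⟨m, k • b, Submodule.smul_mem _ k hb, G, fun H hH => ?_⟩
    simp only [smul_mul_assoc, ← Finset.smul_sum, ← smul_sub]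
    rw [h H hH]

theorem mul_edge_mem_ghostSpan {n : ℕ} {a : A} (ha : a ∈ F.ghostSpan (n + 1)) (e : E.Edge) :
    a * F.edge e ∈ F.ghostSpan n := by
  refine mul_mem_of_forall_mem_mul ha ?_
  rintro _ ⟨l, m, x, hm, rfl⟩
  obtain _ | ⟨f, m⟩ := m
  · rw [path_mul_ghostPath_nil]
    by_cases h : x = E.src e
    · refine Submodule.subset_span ⟨l ++ [e], [], E.rng e, Nat.zero_le _, ?_⟩
      rw [path_mul_ghostPath_nil, path_append, path, path, F.edge_rng, start, h]
    · rw [← F.src_edge, ← mul_assoc, F.path_mul_vert_of_ne _ h, zero_mul]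
      exact Submodule.zero_mem _
  · rw [ghostPath, ← mul_assoc, mul_assoc _ (F.ghost f)]
    by_cases h : f = e
    · subst h
      rw [F.ghost_mul_edge, mul_assoc]
      by_cases h : E.rng f = E.start m x
      · rw [h, ghostPath_mul_vert_start]
        exact Submodule.subset_span ⟨l, m, x, by simpa using hm, rfl⟩
      · rw [F.ghostPath_mul_vert_of_ne h, mul_zero]
        exact Submodule.zero_mem _
    · rw [F.ghost_mul_edge_of_ne _ _ h, mul_zero]
      exact Submodule.zero_mem _

/-- If `a` killed all edges, then `a = b(1 - ∑ e e*)` for a combination `b` of paths, and `b` would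
kill all edges outside `G`. With infinitely many surviving edges at `x` this forces `bx = 0`, and
then `ax = 0`. -/
theorem mul_edge_ne_zero_of_infinite {n : ℕ} {a : A} (ha : a ∈ F.ghostSpan n) {x : E.Vertex}
    (hx : a * F.vert x ≠ 0)
    (hinf : ∀ G : Finset E.Edge, ∃ e ∉ G, E.src e = x ∧ F.vert (E.rng e) ≠ 0) :
    ∃ e, a * F.edge e ≠ 0 := by
  classical
  by_contra! h0
  obtain ⟨m, b, hb, G, hG⟩ := F.exists_finset_sub_sum ha
  have hab : a = b - ∑ e ∈ G, b * F.edge e * F.ghost e := by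
    rw [← hG G subset_rfl]
    simp only [h0, zero_mul, Finset.sum_const_zero, sub_zero]
  have hbe : ∀ e ∉ G, b * F.edge e = 0 := fun e he => by
    have := h0 e
    rwa [hab, sub_mul, Finset.sum_mul, Finset.sum_eq_zero, sub_zero] at this
    intro f hf
    rw [mul_assoc, F.ghost_mul_edge_of_ne f e (by rintro rfl; exact he hf), mul_zero]
  have hbx : b * F.vert x = 0 := by
    by_contra hbx
    obtain ⟨G', hG'⟩ := F.exists_finset_mul_edge_ne_zero hb hbx
    obtain ⟨e, he, hex, her⟩ := hinf (G ∪ G')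
    rw [Finset.mem_union, not_or] at he
    exact hG' e he.2 hex her (hbe e he.1)
  apply hx
  rw [hab, sub_mul, hbx, zero_sub, neg_eq_zero, Finset.sum_mul]
  refine Finset.sum_eq_zero fun f _ => ?_
  by_cases h : E.src f = x
  · subst h
    rw [← F.src_edge, ← mul_assoc b, hbx, zero_mul, zero_mul, zero_mul]
  · rw [mul_assoc, ← F.ghost_src, mul_assoc (F.ghost f), F.vert_mul_vert _ _ h, mul_zero, mul_zero]

/-- Each right multiplication by an edge lowers the bound on the ghost length by one, and the
Leavitt condition guarantees an edge that does not kill `a`. -/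
theorem exists_mul_mem_pathSpan [IsPrimeRing A] (hF : F.IsLeavitt) {n : ℕ} {a : A}
    (ha : a ∈ F.ghostSpan n) (ha0 : a ≠ 0) : ∃ s, a * s ≠ 0 ∧ ∃ m, a * s ∈ F.pathSpan m := by
  induction n generalizing a with
  | zero =>
    obtain ⟨x, hx⟩ := F.exists_mul_vert_ne_zero ha0
    have h0 : F.ghostSpan 0 ≤ ⨆ m, F.pathSpan m := Submodule.span_le.2 <| by
      rintro _ ⟨l, m, y, hm, rfl⟩
      obtain rfl := List.length_eq_zero_iff.1 (Nat.le_zero.1 hm)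
      rw [path_mul_ghostPath_nil]
      exact Submodule.mem_iSup_of_mem l.length (Submodule.subset_span ⟨l, y, le_rfl, rfl⟩)
    obtain ⟨m, hm⟩ := (Submodule.mem_iSup_of_directed _
      (monotone_nat_of_le_succ fun n => F.pathSpan_mono n.le_succ).directed_le).1 (h0 ha)
    refine ⟨F.vert x, hx, m, mul_mem_of_forall_mem_mul hm ?_⟩
    rintro _ ⟨l, y, hl, rfl⟩
    by_cases hxy : y = x
    · subst hxy
      rw [path_mul_vert]
      exact Submodule.subset_span ⟨l, y, hl, rfl⟩
    · rw [F.path_mul_vert_of_ne _ hxy]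
      exact Submodule.zero_mem _
  | succ n ih =>
    obtain ⟨e, he⟩ : ∃ e, a * F.edge e ≠ 0 := by
      obtain ⟨x, hx⟩ := F.exists_mul_vert_ne_zero ha0
      have hx0 : F.vert x ≠ 0 := fun h => hx (by rw [h, mul_zero])
      rcases hF x hx0 with hinf | ⟨G, -, hG⟩
      · exact F.mul_edge_ne_zero_of_infinite ha hx hinf
      · by_contra! h0
        apply hx
        rw [hG, Finset.mul_sum]
        exact Finset.sum_eq_zero fun e _ => by rw [← mul_assoc, h0, zero_mul]
    obtain ⟨s, hs, m, hm⟩ := ih (F.mul_edge_mem_ghostSpan ha e) he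
    exact ⟨F.edge e * s, by rwa [← mul_assoc], m, by rwa [← mul_assoc]⟩

/-- Every nonzero vertex is the source of aperiodic paths ending at nonzero vertices. -/
def HasAperiodicPaths : Prop :=
  ∀ (N : ℕ) (a : E.Vertex), F.vert a ≠ 0 →
    ∃ q u, E.Walk a q u ∧ F.vert u ≠ 0 ∧ Aperiodic N q

theorem conj_posPathSpan {n : ℕ} {r : A} (hr : r ∈ F.posPathSpan n) {a u : E.Vertex}
    {q : List E.Edge} (hw : E.Walk a q u) (hq : Aperiodic n q) :
    F.ghostPath q u * r * F.path q u = 0 := by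
  induction hr using Submodule.span_induction with
  | mem r hr =>
    obtain ⟨l, x, hl, hn, rfl⟩ := hr
    rw [← path_mul_ghostPath_nil]
    exact (F.conj_aperiodic hq hw l [] x hn (Nat.zero_le _)).resolve_right fun h => hl h.1
  | zero => rw [mul_zero, zero_mul]
  | add r s _ _ hr hs => rw [mul_add, add_mul, hr, hs, add_zero]
  | smul k r _ hr => rw [mul_smul_comm, smul_mul_assoc, hr, smul_zero]

theorem exists_conj_eq_smul (x : A) : ∃ N, ∀ (a u : E.Vertex) (q : List E.Edge), E.Walk a q u →
    Aperiodic N q → ∃ k : K, F.ghostPath q u * x * F.path q u = k • F.vert u := by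
  induction F.mem_span_monomials x using Submodule.span_induction with
  | mem x hx =>
    obtain ⟨l, m, y, rfl⟩ := hx
    refine ⟨max l.length m.length, fun a u q hw hq => ?_⟩
    rcases F.conj_aperiodic hq hw l m y (le_max_left _ _) (le_max_right _ _) with h | ⟨-, h⟩
    · exact ⟨0, by rw [h, zero_smul]⟩
    · exact ⟨1, by rw [h, one_smul]⟩
  | zero => exact ⟨0, fun a u q _ _ => ⟨0, by rw [mul_zero, zero_mul, zero_smul]⟩⟩
  | add x y _ _ hx hy =>
    obtain ⟨N, hN⟩ := hx
    obtain ⟨N', hN'⟩ := hy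
    refine ⟨max N N', fun a u q hw hq => ?_⟩
    obtain ⟨k, hk⟩ := hN a u q hw (hq.mono (le_max_left _ _))
    obtain ⟨k', hk'⟩ := hN' a u q hw (hq.mono (le_max_right _ _))
    exact ⟨k + k', by rw [mul_add, add_mul, hk, hk', add_smul]⟩
  | smul c x _ hx =>
    obtain ⟨N, hN⟩ := hx
    refine ⟨N, fun a u q hw hq => ?_⟩
    obtain ⟨k, hk⟩ := hN a u q hw hq
    exact ⟨c * k, by rw [mul_smul_comm, smul_mul_assoc, hk, mul_smul]⟩

/-- A nonzero element of `I` is multiplied on the right until it is free of ghosts, then on both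
sides into `k x + r` with `k ≠ 0` and `r` without constant term. Conjugation by an aperiodic path
from `x` to `u` removes `r` and leaves `k u`. -/
theorem exists_vert_mem [IsPrimeRing A] (hF : F.IsLeavitt) (hap : F.HasAperiodicPaths)
    {I : TwoSidedIdeal A} (hI : I ≠ ⊥) : ∃ u, F.vert u ≠ 0 ∧ F.vert u ∈ I := by
  obtain ⟨a, ha, ha0⟩ : ∃ a ∈ I, a ≠ 0 := by
    by_contra! h0
    exact hI (le_bot_iff.mp fun d hd => (TwoSidedIdeal.mem_bot _).2 (h0 d hd))
  obtain ⟨n, hn⟩ := F.exists_mem_ghostSpan a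
  obtain ⟨s, hs, m, hm⟩ := F.exists_mul_mem_pathSpan hF hn ha0
  obtain ⟨x, hx⟩ := F.exists_mul_vert_ne_zero hs
  obtain ⟨t, k, hk, N, r, hr, h⟩ := F.exists_mul_eq_smul_add hm hx
  have hx0 : F.vert x ≠ 0 := fun h => hx (by rw [h, mul_zero])
  obtain ⟨q, u, hw, hu, hq⟩ := hap N x hx0
  refine ⟨u, hu, ?_⟩
  have h1 : F.ghostPath q u * (k • F.vert x + r) * F.path q u = k • F.vert u := by
    rw [mul_add, add_mul, F.conj_posPathSpan hr hw hq, add_zero, mul_smul_comm, smul_mul_assoc,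
      F.ghostPath_mul_vert hw, F.ghostPath_mul_path hw]
  have h2 : k • F.vert u ∈ I := by
    rw [← h1, ← h]
    exact I.mul_mem_right _ _ (I.mul_mem_left _ _ (I.mul_mem_right _ _ (I.mul_mem_left _ _
      (I.mul_mem_right _ _ ha))))
  have h3 := I.mul_mem_left (k⁻¹ • F.vert u) _ h2
  rwa [smul_mul_assoc, mul_smul_comm, F.vert_mul_self, smul_smul, inv_mul_cancel₀ hk, one_smul]
    at h3

open MartindaleQuotient in
/-- In the aperiodic case the extended centroid is the field of scalars. -/
theorem extendedCentroid_isAlgebraic [IsPrimeRing A] (hF : F.IsLeavitt)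
    (hap : F.HasAperiodicPaths) : Algebra.IsAlgebraic K (extendedCentroid K A) where
  isAlgebraic z := by
    have hz : ∀ y, y * z.1 = z.1 * y := Subalgebra.mem_center_iff.1 z.2
    obtain ⟨I, hI, hI'⟩ := exists_ideal z.1
    obtain ⟨x, hx, hxI⟩ := F.exists_vert_mem hF hap hI
    obtain ⟨b, hb⟩ := hI' _ hxI
    obtain ⟨N, hN⟩ := F.exists_conj_eq_smul b
    obtain ⟨q, u, hw, hu, hq⟩ := hap N x hx
    obtain ⟨k, hk⟩ := hN x u q hw hq
    -- `z u = z (q* x q) = q* (z x) q = q* b q` by centrality, which is `k u` by the choice of `q`.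
    have hzu : z.1 * of (F.vert u) = of (k • F.vert u) := by
      rw [← hk, of_mul, of_mul, ← hb, ← mul_assoc, hz, mul_assoc, mul_assoc, ← of_mul, ← of_mul,
        F.vert_mul_path hw, F.ghostPath_mul_path hw]
    have hzk : z = algebraMap K _ k := by
      rw [← sub_eq_zero]
      refine Subtype.ext (eq_zero_of_central_mul_of (z := (z - algebraMap K _ k).1)
        (Subalgebra.mem_center_iff.1 (z - algebraMap K _ k).2) hu ?_)
      change (z.1 - algebraMap K _ k) * of (F.vert u) = 0
      rw [sub_mul, hzu, algebraMap_mul_of, sub_self]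
    rw [hzk]
    exact isAlgebraic_algebraMap k

end CohnFamily

/-! ### Corners generated by an invertible element -/

/-- Some nonzero corner of `A` is a commutative algebra of finite type. -/
def HasCommCorner (K : Type u) [Field K] (A : Type v) [NonUnitalRing A] [Module K A] : Prop :=
  ∃ (B : Type v) (_ : CommRing B) (_ : Algebra K B) (_ : Nontrivial B)
    (_ : Algebra.FiniteType K B), Nonempty (CommCorner K A B)

section Corner

variable {K : Type u} [Field K] {A : Type v} [NonUnitalRing A] [Module K A]
  [IsScalarTower K A A] [SMulCommClass K A A] {q : A} (hq : IsIdempotentElem q)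

namespace IsIdempotentElem.Corner

/-- Scalars act on the corner of an idempotent. -/
@[reducible]
def module : Module K hq.Corner :=
  letI : SMul K hq.Corner := ⟨fun k x => ⟨k • x.1, by
    obtain ⟨a, ha⟩ := x.2
    exact ⟨k • a, by simp only [← ha, mul_smul_comm, smul_mul_assoc]⟩⟩⟩
  Function.Injective.module K (⟨⟨Subtype.val, rfl⟩, fun _ _ => rfl⟩ : hq.Corner →+ A)
    Subtype.val_injective fun _ _ => rfl

/-- A corner with commuting elements is a commutative ring. -/
@[reducible]
def commRing (h : ∀ x y : hq.Corner, x * y = y * x) : CommRing hq.Corner where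
  __ : Ring hq.Corner := inferInstance
  mul_comm := h

/-- A corner with commuting elements is a commutative algebra. -/
@[reducible]
def algebra (h : ∀ x y : hq.Corner, x * y = y * x) :
    letI := commRing hq h
    Algebra K hq.Corner :=
  letI := commRing hq h
  letI := module (K := K) hq
  Algebra.ofModule (fun _ _ _ => Subtype.ext (smul_mul_assoc _ _ _))
    (fun _ _ _ => Subtype.ext (mul_smul_comm _ _ _))

end IsIdempotentElem.Corner

/-- A corner generated by two mutually inverse elements is a commutative algebra of finite type. -/
theorem hasCommCorner (hq : IsIdempotentElem q) (hq0 : q ≠ 0) {x y : A}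
    (hqx : q * x = x) (hxq : x * q = x)
    (hqy : q * y = y) (hyq : y * q = y) (hxy : x * y = q) (hyx : y * x = q)
    (hgen : ∀ S : Submodule K A, q ∈ S → (∀ s ∈ S, x * s ∈ S) → (∀ s ∈ S, y * s ∈ S) →
      ∀ a, q * a * q ∈ S) :
    HasCommCorner K A := by
  -- `hgen` applied to the centralizer of `t`. Taking `t = x` and `t = y` first shows that both are
  -- central in the corner; then `t` may be any corner element.
  have hcomm (t : A) (hqt : q * t = t * q) (hxt : x * t = t * x) (hyt : y * t = t * y) (a : A) :
      q * a * q * t = t * (q * a * q) := by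
    refine (hgen (LinearMap.eqLocus (LinearMap.mulRight K t) (LinearMap.mulLeft K t)) hqt ?_ ?_ a :)
    · intro s (hs : s * t = t * s)
      change x * s * t = t * (x * s)
      rw [mul_assoc, hs, ← mul_assoc, hxt, mul_assoc]
    · intro s (hs : s * t = t * s)
      change y * s * t = t * (y * s)
      rw [mul_assoc, hs, ← mul_assoc, hyt, mul_assoc]
  have hx := hcomm x (hqx.trans hxq.symm) rfl (hyx.trans hxy.symm)
  have hy := hcomm y (hqy.trans hyq.symm) (hxy.trans hyx.symm) rfl
  have hc : ∀ b c : hq.Corner, b * c = c * b := by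
    rintro ⟨_, a, rfl⟩ ⟨_, b, rfl⟩
    refine Subtype.ext (hcomm (q * b * q) ?_ (hx b).symm (hy b).symm a)
    rw [← mul_assoc, ← mul_assoc, hq.eq, mul_assoc _ q, hq.eq]
  let := IsIdempotentElem.Corner.commRing hq hc
  let := IsIdempotentElem.Corner.algebra (K := K) hq hc
  let j : CommCorner K A hq.Corner :=
    { toLinearMap := ⟨⟨Subtype.val, fun _ _ => rfl⟩, fun _ _ => rfl⟩
      map_mul := fun _ _ => rfl
      injective := Subtype.val_injective
      compress := AddMonoidHom.mk' (fun a => ⟨q * a * q, a, rfl⟩)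
        fun a b => Subtype.ext (by
          change q * (a + b) * q = q * a * q + q * b * q
          rw [mul_add, add_mul])
      compress_spec := fun _ => rfl }
  let x' : hq.Corner := ⟨x, x, by change q * x * q = x; rw [hqx, hxq]⟩
  let y' : hq.Corner := ⟨y, y, by change q * y * q = y; rw [hqy, hyq]⟩
  have : Nontrivial hq.Corner := ⟨⟨1, 0, fun h => hq0 (congrArg Subtype.val h)⟩⟩
  refine ⟨hq.Corner, inferInstance, inferInstance, this,
    ⟨Subalgebra.fg_def.2 ⟨{x', y'}, Set.toFinite _, ?_⟩⟩, ⟨j⟩⟩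
  rw [eq_top_iff]
  intro b _
  -- `hgen` again, now for the image in `A` of the subalgebra generated by `x` and `y`.
  obtain ⟨c, hc, hcb⟩ : b.1 ∈ (Subalgebra.toSubmodule (Algebra.adjoin K {x', y'})).map
      j.toLinearMap := by
    obtain ⟨a, ha⟩ := b.2
    rw [← ha]
    refine hgen ((Subalgebra.toSubmodule (Algebra.adjoin K {x', y'})).map j.toLinearMap)
      ⟨1, Subalgebra.one_mem _, rfl⟩ ?_ ?_ a
    · rintro _ ⟨s, hs, rfl⟩
      exact ⟨x' * s, Subalgebra.mul_mem _ (Algebra.subset_adjoin (by simp)) hs, rfl⟩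
    · rintro _ ⟨s, hs, rfl⟩
      exact ⟨y' * s, Subalgebra.mul_mem _ (Algebra.subset_adjoin (by simp)) hs, rfl⟩
  rwa [← Subtype.ext hcb]

end Corner

/-! ### Aperiodic paths, isolated cycles and the resulting corners -/

namespace CohnFamily

open DirectedGraph

variable {K : Type u} [Field K] {E : DirectedGraph.{v, w}} {A : Type*} [NonUnitalRing A]
  [Module K A] (F : CohnFamily K E A)

/-- Paths from `a` with nonzero end are determined by their length. -/
def UniquePaths (a : E.Vertex) : Prop :=
  ∀ q q' x x', E.Walk a q x → F.vert x ≠ 0 → E.Walk a q' x' → F.vert x' ≠ 0 →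
    q.length = q'.length → q = q'

/-- There is a cycle all of whose vertices emit only one nonzero edge. -/
def HasIsolatedCycle : Prop :=
  ∃ a c, F.vert a ≠ 0 ∧ F.UniquePaths a ∧ c ≠ [] ∧ E.Walk a c a

theorem IsLeavitt.exists_edge {F : CohnFamily K E A} (hF : F.IsLeavitt) {a : E.Vertex}
    (ha : F.vert a ≠ 0) : ∃ e, E.src e = a ∧ F.vert (E.rng e) ≠ 0 := by
  rcases hF a ha with h | ⟨G, hG, h⟩
  · obtain ⟨e, -, he⟩ := h ∅
    exact ⟨e, he⟩
  · by_contra! h0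
    refine ha (h.trans (Finset.sum_eq_zero fun e he => ?_))
    rw [F.edge_eq_zero (h0 e (hG e he)), zero_mul]

theorem IsLeavitt.exists_walk {F : CohnFamily K E A} (hF : F.IsLeavitt) (n : ℕ) {a : E.Vertex}
    (ha : F.vert a ≠ 0) : ∃ q x, E.Walk a q x ∧ F.vert x ≠ 0 ∧ q.length = n := by
  induction n generalizing a with
  | zero => exact ⟨[], a, rfl, ha, rfl⟩
  | succ n ih =>
    obtain ⟨e, rfl, he⟩ := hF.exists_edge ha
    obtain ⟨q, x, hq, hx, hn⟩ := ih he
    exact ⟨e :: q, x, ⟨rfl, hq⟩, hx, by rw [List.length_cons, hn]⟩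

/-- If every surviving continuation of `p` repeats with period `j - i` from position `i` on, each
new letter is dictated by an earlier one. So paths from the end of `p` are unique, and they close up
after `j - i` steps. -/
theorem IsLeavitt.hasIsolatedCycle_of_periodic {F : CohnFamily K E A} (hF : F.IsLeavitt)
    {a u : E.Vertex} {p : List E.Edge} (hp : E.Walk a p u) (hu : F.vert u ≠ 0) {i j : ℕ}
    (hij : i < j) (hper : ∀ q x, E.Walk u q x → F.vert x ≠ 0 → ∀ k,
      j + k < (p ++ q).length → (p ++ q)[i + k]? = (p ++ q)[j + k]?) :
    F.HasIsolatedCycle := by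
  -- Lengthening `p` by `j` edges preserves the hypothesis, since continuations of the longer path
  -- are continuations of `p`.
  wlog hj : j ≤ p.length generalizing p u
  · obtain ⟨r, y, hr, hy, hn⟩ := hF.exists_walk j hu
    refine this (hp.append hr) hy (fun q x hq hx k hk => ?_)
      (by rw [List.length_append]; omega)
    rw [List.append_assoc] at hk ⊢
    exact hper _ x (hr.append hq) hx k hk
  have huniq : F.UniquePaths u := by
    intro q q' x x' hq hx hq' hx' hlen
    refine List.append_cancel_left (as := p) (List.ext_getElem? fun n => ?_)
    induction n using Nat.strong_induction_on with
    | _ n ih =>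
      by_cases hn : n < p.length
      · rw [List.getElem?_append_left hn, List.getElem?_append_left hn]
      by_cases hn' : n < (p ++ q).length
      · have hn'' : n < (p ++ q').length := by
          rwa [List.length_append, ← hlen, ← List.length_append]
        have e1 : n = j + (n - j) := by omega
        have h1 := hper q x hq hx (n - j) (by omega)
        have h2 := hper q' x' hq' hx' (n - j) (by omega)
        rw [← e1] at h1 h2
        rw [← h1, ← h2]
        exact ih _ (by omega)
      · rw [List.getElem?_eq_none (by omega), List.getElem?_eq_none]
        rw [List.length_append] at hn' ⊢
        omega
  obtain ⟨c, y, hc, hy, hlen⟩ := hF.exists_walk (j - i) hu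
  -- One edge beyond the period: `e` must equal the first edge of `c`, so its source, the end of
  -- `c`, is `u`.
  obtain ⟨e, rfl, he⟩ := hF.exists_edge hy
  have hk : j + (p.length - i) < (p ++ (c ++ [e])).length := by
    rw [List.length_append, List.length_append, List.length_singleton]
    omega
  have h := hper (c ++ [e]) (E.rng e) (hc.append ⟨rfl, rfl⟩) he (p.length - i) hk
  have happ : ∀ n, (p ++ (c ++ [e]))[p.length + n]? = (c ++ [e])[n]? := fun n => by
    rw [List.getElem?_append_right (Nat.le_add_right _ _), Nat.add_sub_cancel_left]
  rw [show i + (p.length - i) = p.length + 0 by omega,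
    show j + (p.length - i) = p.length + c.length by omega, happ, happ,
    List.getElem?_append_right le_rfl, Nat.sub_self] at h
  obtain _ | ⟨f, c⟩ := c
  · simp at hlen; omega
  obtain rfl : f = e := by simpa using h
  exact ⟨u, f :: c, hu, huniq, List.cons_ne_nil _ _, hc.1 ▸ hc⟩

/-- The finitely many pairs of positions up to `N` are separated one at a time by extending the
path; a mismatch once found persists. A pair that no extension separates yields an isolated cycle.
-/
theorem IsLeavitt.hasAperiodicPaths_or {F : CohnFamily K E A} (hF : F.IsLeavitt) :
    F.HasAperiodicPaths ∨ F.HasIsolatedCycle := by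
  by_cases hc : F.HasIsolatedCycle
  · exact Or.inr hc
  refine Or.inl fun N a ha => ?_
  have key : ∀ T : Finset (ℕ × ℕ), ∃ q u, E.Walk a q u ∧ F.vert u ≠ 0 ∧ N ≤ q.length ∧
      ∀ t ∈ T, t.1 < t.2 → ∃ i, ∃ h : t.2 + i < q.length, q[t.1 + i]? ≠ some q[t.2 + i] := by
    intro T
    induction T using Finset.induction_on with
    | empty =>
      obtain ⟨q, u, hq, hu, hn⟩ := hF.exists_walk N ha
      exact ⟨q, u, hq, hu, hn.ge, by simp⟩
    | insert t T _ ih =>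
      obtain ⟨p, u, hp, hu, hn, hT⟩ := ih
      by_cases ht : t.1 < t.2
      · obtain ⟨q, x, hq, hx, k, hk, hne⟩ : ∃ q x, E.Walk u q x ∧ F.vert x ≠ 0 ∧ ∃ k,
            t.2 + k < (p ++ q).length ∧ (p ++ q)[t.1 + k]? ≠ (p ++ q)[t.2 + k]? := by
          by_contra! h
          exact hc (hF.hasIsolatedCycle_of_periodic hp hu ht h)
        refine ⟨p ++ q, x, hp.append hq, hx, by rw [List.length_append]; omega, ?_⟩
        intro s hs hlt
        rcases Finset.mem_insert.1 hs with rfl | hs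
        · exact ⟨k, hk, by rwa [← List.getElem?_eq_getElem]⟩
        · obtain ⟨i, hi, hne⟩ := hT s hs hlt
          have hi' : s.2 + i < (p ++ q).length := by rw [List.length_append]; omega
          refine ⟨i, hi', ?_⟩
          rwa [← List.getElem?_eq_getElem, List.getElem?_append_left hi,
            List.getElem?_append_left (by omega), List.getElem?_eq_getElem hi]
      · refine ⟨p, u, hp, hu, hn, fun s hs hlt => ?_⟩
        rcases Finset.mem_insert.1 hs with rfl | hs
        · exact absurd hlt ht
        · exact hT s hs hlt
  obtain ⟨q, u, hq, hu, hn, hT⟩ := key (Finset.range (N + 1) ×ˢ Finset.range (N + 1))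
  refine ⟨q, u, hq, hu, hn, fun i j hij hj => hT (i, j) ?_ hij⟩
  simp only [Finset.mem_product, Finset.mem_range]
  omega

/-- Every vertex met before the end of the path emits a single surviving edge `e`, so the Leavitt
condition there reduces to `s(e) = e e*`, and `q q*` telescopes. -/
theorem IsLeavitt.path_mul_ghostPath {F : CohnFamily K E A} (hF : F.IsLeavitt) {a x : E.Vertex}
    (ha : F.UniquePaths a) {q : List E.Edge} (hq : E.Walk a q x) (hx : F.vert x ≠ 0) :
    F.path q x * F.ghostPath q x = F.vert a := by
  induction q generalizing a with
  | nil =>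
    obtain rfl : a = x := hq
    exact F.vert_mul_self a
  | cons e q ih =>
    obtain ⟨rfl, hq⟩ := hq
    have hr : F.vert (E.rng e) ≠ 0 := F.vert_ne_zero_of_walk hq hx
    have hr' : F.UniquePaths (E.rng e) := fun p p' y y' hp hy hp' hy' h =>
      (List.cons.inj (ha (e :: p) (e :: p') y y' ⟨rfl, hp⟩ hy ⟨rfl, hp'⟩ hy'
        (by simpa using h))).2
    have hs : F.vert (E.src e) ≠ 0 :=
      F.vert_ne_zero_of_walk (l := [e]) (x := E.rng e) ⟨rfl, rfl⟩ hr
    have huniq : ∀ f, E.src f = E.src e → F.vert (E.rng f) ≠ 0 → f = e := fun f hf hfr =>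
      (List.cons.inj (ha [f] [e] _ _ ⟨hf, rfl⟩ hfr ⟨rfl, rfl⟩ hr rfl)).1
    rw [path, ghostPath, mul_assoc, ← mul_assoc (F.path q x), ih hr' hq, F.rng_ghost]
    rcases hF _ hs with h | ⟨G, hG, h⟩
    · obtain ⟨f, hf, hfs, hfr⟩ := h {e}
      exact absurd (Finset.mem_singleton.2 (huniq f hfs hfr)) hf
    · have h0 : ∀ f ∈ G, f ≠ e → F.edge f * F.ghost f = 0 := fun f hf hfe => by
        rw [F.edge_eq_zero (by_contra fun h => hfe (huniq f (hG f hf) h)), zero_mul]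
      rw [h, Finset.sum_eq_single e h0]
      intro he
      exact absurd (h.trans (Finset.sum_eq_zero fun f hf => h0 f hf fun h => he (h ▸ hf))) hs

variable [IsScalarTower K A A] [SMulCommClass K A A]

/-- For a shortest closed path `c` at `a`, uniqueness of paths makes every closed path at `a` a
power of `c`, and `c c* = a = c* c`. So the corner at `a` is generated by `c` and its inverse `c*`.
-/
theorem IsLeavitt.hasCommCorner_of_isolatedCycle {F : CohnFamily K E A} (hF : F.IsLeavitt)
    (hc : F.HasIsolatedCycle) :
    HasCommCorner K A := by
  classical
  obtain ⟨a, c, ha, huniq, hc, hmin⟩ : ∃ a c, F.vert a ≠ 0 ∧ F.UniquePaths a ∧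
      (c ≠ [] ∧ E.Walk a c a) ∧ ∀ l, l ≠ [] → E.Walk a l a → c.length ≤ l.length := by
    obtain ⟨a, c, ha, huniq, hc⟩ := hc
    have hex : ∃ n, ∃ c, (c ≠ [] ∧ E.Walk a c a) ∧ c.length = n := ⟨_, c, hc, rfl⟩
    obtain ⟨c, hc, hn⟩ := Nat.find_spec hex
    exact ⟨a, c, ha, huniq, hc, fun l hl hw => hn ▸ Nat.find_min' hex ⟨l, ⟨hl, hw⟩, rfl⟩⟩
  obtain ⟨hc0, hc⟩ := hc
  have hstart : ∀ {l : List E.Edge}, E.Walk a l a → l = [] ∨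
      ∃ l', l = c ++ l' ∧ E.Walk a l' a := by
    intro l hl
    by_cases h0 : l = []
    · exact Or.inl h0
    have hlen := hmin l h0 hl
    have hl' := hl
    rw [← List.take_append_drop c.length l] at hl'
    obtain ⟨h1, h2⟩ := hl'.of_append
    have h3 : l.take c.length = c := huniq _ _ _ _ h1 (F.vert_ne_zero_of_walk h2 ha) hc ha
      (by rw [List.length_take]; omega)
    rw [h3] at h1
    rw [h1.eq_of_walk hc] at h2
    exact Or.inr ⟨_, by conv_lhs => rw [← List.take_append_drop c.length l, h3], h2⟩
  have hlong : ∀ n, ∃ l, n ≤ l.length ∧ E.Walk a l a := by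
    intro n
    induction n with
    | zero => exact ⟨[], le_rfl, rfl⟩
    | succ n ih =>
      obtain ⟨l, hl, hw⟩ := ih
      refine ⟨c ++ l, ?_, hc.append hw⟩
      have := List.length_pos_iff.2 hc0
      rw [List.length_append]
      omega
  -- By uniqueness, `l` is a prefix of any sufficiently long closed path at `a`; the remainder leads
  -- back.
  have hreturn : ∀ {l x}, E.Walk a l x → F.vert x ≠ 0 → ∃ m, E.Walk x m a := by
    intro l x hl hx
    obtain ⟨p, hp, hw⟩ := hlong l.length
    rw [← List.take_append_drop l.length p] at hw
    obtain ⟨h1, h2⟩ := hw.of_append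
    have h3 : p.take l.length = l := huniq _ _ _ _ h1 (F.vert_ne_zero_of_walk h2 ha) hl hx
      (by rw [List.length_take]; omega)
    rw [h3] at h1
    rw [h1.eq_of_walk hl] at h2
    exact ⟨_, h2⟩
  refine _root_.hasCommCorner (K := K) (F.vert_mul_self a) ha (x := F.path c a)
    (y := F.ghostPath c a)
    (F.vert_mul_path hc) (F.path_mul_vert c a) (F.vert_mul_ghostPath c a) (F.ghostPath_mul_vert hc)
    (hF.path_mul_ghostPath huniq hc ha) (F.ghostPath_mul_path hc) fun S h1 hx hy b => ?_
  have hpath : ∀ n l, l.length ≤ n → E.Walk a l a → ∀ s ∈ S, F.vert a * s = s →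
      F.path l a * s ∈ S := by
    intro n
    induction n with
    | zero =>
      intro l hl _ s hs has
      rw [List.length_eq_zero_iff.1 (Nat.le_zero.1 hl), path, has]
      exact hs
    | succ n ih =>
      intro l hl hw s hs has
      rcases hstart hw with rfl | ⟨l', rfl, hw'⟩
      · rw [path, has]
        exact hs
      · rw [path_append, hw'.start_eq, mul_assoc]
        have := List.length_pos_iff.2 hc0
        rw [List.length_append] at hl
        exact hx _ (ih l' (by omega) hw' s hs has)
  have hghost : ∀ n l, l.length ≤ n → E.Walk a l a → ∀ s ∈ S, F.vert a * s = s →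
      F.ghostPath l a * s ∈ S := by
    intro n
    induction n with
    | zero =>
      intro l hl _ s hs has
      rw [List.length_eq_zero_iff.1 (Nat.le_zero.1 hl), ghostPath, has]
      exact hs
    | succ n ih =>
      intro l hl hw s hs has
      rcases hstart hw with rfl | ⟨l', rfl, hw'⟩
      · rw [ghostPath, has]
        exact hs
      · rw [ghostPath_append, hw'.start_eq, mul_assoc]
        have := List.length_pos_iff.2 hc0
        rw [List.length_append] at hl
        refine ih l' (by omega) hw' _ (hy s hs) ?_
        rw [← mul_assoc, vert_mul_ghostPath]
  refine mul_mem_of_forall_mem_mul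
    (X := {z | ∃ l m x, z = F.vert a * (F.path l x * F.ghostPath m x)})
    (mul_mem_of_forall_mul_mem (S := Submodule.span K _) (F.mem_span_monomials b) ?_) ?_
  · rintro _ ⟨l, m, x, rfl⟩
    exact Submodule.subset_span ⟨l, m, x, rfl⟩
  rintro _ ⟨l, m, x, rfl⟩
  by_cases hl : a = E.start l x; swap
  · rw [← mul_assoc, F.vert_mul_path_of_ne hl, zero_mul, zero_mul]
    exact S.zero_mem
  by_cases hm : a = E.start m x; swap
  · rw [mul_assoc, mul_assoc, F.ghostPath_mul_vert_of_ne hm, mul_zero, mul_zero]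
    exact S.zero_mem
  by_cases hlw : E.Walk a l x; swap
  · rw [F.path_eq_zero (hl ▸ hlw), zero_mul, mul_zero, zero_mul]
    exact S.zero_mem
  by_cases hmw : E.Walk a m x; swap
  · rw [F.ghostPath_eq_zero (hm ▸ hmw), mul_zero, mul_zero, zero_mul]
    exact S.zero_mem
  by_cases hx0 : F.vert x = 0
  · rw [← F.path_mul_vert, hx0, mul_zero, zero_mul, mul_zero, zero_mul]
    exact S.zero_mem
  obtain ⟨p, hp⟩ := hreturn hlw hx0
  have hx' : F.UniquePaths x := fun r r' y y' hr hy hr' hy' h =>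
    List.append_cancel_left (huniq (l ++ r) (l ++ r') y y' (hlw.append hr) hy (hlw.append hr') hy'
      (by simpa using h))
  -- Inserting `x = p p*` for a return path `p` turns `l m*` into `(lp)(mp)*`, a product of a closed
  -- path and a closed ghost path at `a`.
  have e : F.vert a * (F.path l x * F.ghostPath m x) * F.vert a =
      F.path (l ++ p) a * (F.ghostPath (m ++ p) a * F.vert a) := by
    rw [F.ghostPath_mul_vert (hmw.append hp), path_append, ghostPath_append, hp.start_eq,
      mul_assoc (F.path l x), ← mul_assoc (F.path p a), hF.path_mul_ghostPath hx' hp ha,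
      vert_mul_ghostPath, ← mul_assoc, F.vert_mul_path hlw, mul_assoc, F.ghostPath_mul_vert hmw]
  rw [e]
  refine hpath _ _ le_rfl (hlw.append hp) _
    (hghost _ _ le_rfl (hmw.append hp) _ h1 (F.vert_mul_self a)) ?_
  rw [← mul_assoc, vert_mul_ghostPath]

/-- At a vertex `x` where the condition fails, `q = x - ∑ e e*` over a finite set containing all
surviving edges at `x` is a nonzero idempotent with `qe = 0` and `e*q = 0` for every edge. Only
vertices survive compression by `q`, so the corner is `Kq`. Sinks are included, with an empty sum.
-/
theorem hasCommCorner_of_not_isLeavitt (hF : ¬ F.IsLeavitt) :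
    HasCommCorner K A := by
  classical
  unfold IsLeavitt at hF
  push Not at hF
  obtain ⟨x, hx, ⟨G₀, hG₀⟩, hne⟩ := hF
  set G := G₀.filter fun e => E.src e = x with hG
  have hGs : ∀ e ∈ G, E.src e = x := fun e he => (Finset.mem_filter.1 he).2
  have hdead : ∀ e, e ∉ G → E.src e = x → F.vert (E.rng e) = 0 := fun e he hex =>
    hG₀ e (fun h => he (Finset.mem_filter.2 ⟨h, hex⟩)) hex
  obtain ⟨q, hq⟩ : ∃ q, q = F.vert x - ∑ e ∈ G, F.edge e * F.ghost e := ⟨_, rfl⟩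
  have hq0 : q ≠ 0 := fun h => hne G hGs (sub_eq_zero.1 (hq.symm.trans h))
  have hqe : ∀ e, q * F.edge e = 0 := by
    intro e
    rw [hq, sub_mul, Finset.sum_mul]
    by_cases hex : E.src e = x
    · subst hex
      rw [F.src_edge]
      by_cases he : e ∈ G
      · rw [Finset.sum_eq_single_of_mem e he, mul_assoc, F.ghost_mul_edge, F.edge_rng, sub_self]
        intro f _ hf
        rw [mul_assoc, F.ghost_mul_edge_of_ne _ _ hf, mul_zero]
      · rw [F.edge_eq_zero (hdead e he rfl)]
        simp
    · rw [← F.src_edge, ← mul_assoc, F.vert_mul_vert _ _ (Ne.symm hex), zero_mul, zero_sub,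
        neg_eq_zero]
      refine Finset.sum_eq_zero fun f hf => ?_
      rw [F.src_edge, mul_assoc,
        F.ghost_mul_edge_of_ne f e (by rintro rfl; exact hex (hGs _ hf)), mul_zero]
  have heq : ∀ e, F.ghost e * q = 0 := by
    intro e
    rw [hq, mul_sub, Finset.mul_sum]
    by_cases hex : E.src e = x
    · subst hex
      rw [F.ghost_src]
      by_cases he : e ∈ G
      · rw [Finset.sum_eq_single_of_mem e he, ← mul_assoc, F.ghost_mul_edge, F.rng_ghost, sub_self]
        intro f _ hf
        rw [← mul_assoc, F.ghost_mul_edge_of_ne _ _ hf.symm, zero_mul]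
      · rw [← F.rng_ghost, hdead e he rfl]
        simp
    · rw [← F.ghost_src, mul_assoc, F.vert_mul_vert _ _ hex, mul_zero, zero_sub,
        neg_eq_zero]
      refine Finset.sum_eq_zero fun f hf => ?_
      rw [F.ghost_src, ← mul_assoc,
        F.ghost_mul_edge_of_ne e f (by rintro rfl; exact hex (hGs _ hf)), zero_mul]
  have hqx : q * F.vert x = q := by
    rw [hq, sub_mul, F.vert_mul_self, Finset.sum_mul]
    congr 1
    refine Finset.sum_congr rfl fun e he => ?_
    rw [mul_assoc, ← hGs e he, F.ghost_src]
  have hxq : F.vert x * q = q := by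
    rw [hq, mul_sub, F.vert_mul_self, Finset.mul_sum]
    congr 1
    refine Finset.sum_congr rfl fun e he => ?_
    rw [← mul_assoc, ← hGs e he, F.src_edge]
  have hqq : q * q = q := by
    conv_lhs => rw [hq, ← hq]
    conv_lhs => enter [2]; rw [hq]
    rw [mul_sub, hqx, Finset.mul_sum, Finset.sum_eq_zero, sub_zero]
    intro e _
    rw [← mul_assoc, hqe, zero_mul]
  -- The two inverse generators are both taken to be `q`, the identity of the corner.
  refine hasCommCorner (K := K) hqq hq0 hqq hqq hqq hqq hqq hqq fun S hS _ _ b => ?_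
  refine mul_mem_of_forall_mem_mul (X := {z | ∃ l m x, z = q * (F.path l x * F.ghostPath m x)})
    (mul_mem_of_forall_mul_mem (S := Submodule.span K _) (F.mem_span_monomials b) ?_) ?_
  · rintro _ ⟨l, m, x, rfl⟩
    exact Submodule.subset_span ⟨l, m, x, rfl⟩
  rintro _ ⟨l, m, y, rfl⟩
  obtain _ | ⟨e, l⟩ := l; swap
  · rw [path, ← mul_assoc, ← mul_assoc, hqe, zero_mul, zero_mul, zero_mul]
    exact S.zero_mem
  obtain _ | ⟨e, m⟩ := m; swap
  · rw [ghostPath, ← mul_assoc, ← mul_assoc, mul_assoc, heq, mul_zero]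
    exact S.zero_mem
  rw [path, ghostPath, F.vert_mul_self]
  by_cases hxy : x = y
  · rwa [← hxy, hqx, hqq]
  · rw [← hqx, mul_assoc q, F.vert_mul_vert _ _ hxy, mul_zero, zero_mul]
    exact S.zero_mem

end CohnFamily

/-! ### The graph family of a prime quotient of a Leavitt path algebra -/

namespace LeavittPathAlgebra

open DirectedGraph

variable (K : Type u) [Field K] (E : DirectedGraph.{v, w})

variable {E} in
/-- The image of a generator in the Leavitt path algebra. -/
noncomputable def mkGen (x : E.Generator) : LeavittPathAlgebra K E :=
  (gen K x : (con K E).Quotient)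

variable {K E} in
theorem mk_eq_of_rel {a b : FreeAlg K E} (h : Rel K E a b) :
    (a : (con K E).Quotient) = (b : (con K E).Quotient) :=
  (RingCon.eq _).2 (RingConGen.Rel.of _ _ ⟨1, a, b, h, (one_smul K a).symm, (one_smul K b).symm⟩)

theorem eq_top_of_forall_gen_mul (S : Submodule K (LeavittPathAlgebra K E))
    (h1 : ∀ x, mkGen K x ∈ S) (h2 : ∀ x, ∀ s ∈ S, mkGen K x * s ∈ S) : S = ⊤ := by
  refine eq_top_iff.2 fun a _ => ?_
  obtain ⟨f, rfl⟩ := Quotient.mk''_surjective a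
  let φ : FreeAlg K E →ₗ[K] LeavittPathAlgebra K E :=
    ⟨⟨fun f => (f : (con K E).Quotient), fun _ _ => rfl⟩, fun _ _ => rfl⟩
  suffices h : S.comap φ = ⊤ by
    have : f ∈ S.comap φ := h ▸ trivial
    exact this
  have hw : ∀ m : FreeSemigroup E.Generator, φ (MonoidAlgebra.single m 1) ∈ S := by
    intro m
    induction m using FreeSemigroup.recOnMul with
    | ih1 x => exact h1 x
    | ih2 x m _ hm =>
      have e : (MonoidAlgebra.single (FreeSemigroup.of x * m) 1 : FreeAlg K E) =
          gen K x * MonoidAlgebra.single m 1 := by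
        rw [gen, MonoidAlgebra.single_mul_single, mul_one]
      rw [e]
      exact h2 x _ hm
  refine eq_top_iff.2 fun f _ => ?_
  induction f using MonoidAlgebra.induction_linear with
  | zero => exact Submodule.zero_mem _
  | add f g hf hg => exact Submodule.add_mem _ (hf trivial) (hg trivial)
  | single m k =>
    have e : (MonoidAlgebra.single m k : FreeAlg K E) = k • MonoidAlgebra.single m 1 := by
      rw [MonoidAlgebra.smul_single, smul_eq_mul, mul_one]
    rw [e]
    exact Submodule.smul_mem _ _ (hw m)

/-- The images of the generators in a quotient of a Leavitt path algebra. -/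
noncomputable def quotientFamily (P : TwoSidedIdeal (LeavittPathAlgebra K E)) [P.IsPrime] :
    CohnFamily K E P.ringCon.Quotient where
  vert a := (mkGen K (.vertex a) : P.ringCon.Quotient)
  edge e := (mkGen K (.edge e) : P.ringCon.Quotient)
  ghost e := (mkGen K (.ghost e) : P.ringCon.Quotient)
  vert_mul_self a := congrArg RingCon.toQuotient (mk_eq_of_rel (Rel.idem a))
  vert_mul_vert a b h := congrArg RingCon.toQuotient (mk_eq_of_rel (Rel.orth a b h))
  src_edge e := congrArg RingCon.toQuotient (mk_eq_of_rel (Rel.src_edge e))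
  edge_rng e := congrArg RingCon.toQuotient (mk_eq_of_rel (Rel.edge_rng e))
  rng_ghost e := congrArg RingCon.toQuotient (mk_eq_of_rel (Rel.rng_ghost e))
  ghost_src e := congrArg RingCon.toQuotient (mk_eq_of_rel (Rel.ghost_src e))
  ghost_mul_edge e := congrArg RingCon.toQuotient (mk_eq_of_rel (Rel.ck1_same e))
  ghost_mul_edge_of_ne e f h := congrArg RingCon.toQuotient (mk_eq_of_rel (Rel.ck1_ne e f h))
  eq_top S hv he hg hv' he' hg' := by
    let φ : LeavittPathAlgebra K E →ₗ[K] P.ringCon.Quotient :=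
      ⟨⟨fun f => (f : P.ringCon.Quotient), fun _ _ => rfl⟩, fun _ _ => rfl⟩
    have h : S.comap φ = ⊤ := eq_top_of_forall_gen_mul K E _
      (fun x => by
        cases x with
        | vertex a => exact hv a
        | edge e => exact he e
        | ghost e => exact hg e)
      (fun x s hs => by
        cases x with
        | vertex a => exact hv' a _ hs
        | edge e => exact he' e _ hs
        | ghost e => exact hg' e _ hs)
    refine eq_top_iff.2 fun a _ => ?_
    obtain ⟨f, rfl⟩ := Quotient.mk''_surjective a
    have : f ∈ S.comap φ := h ▸ trivial
    exact this

end LeavittPathAlgebra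

theorem mainTheorem2 (K : Type u) [Field K] (E : DirectedGraph.{v, w})
    (P : TwoSidedIdeal (LeavittPathAlgebra K E)) [P.IsPrime] (hP : P.IsLocallyClosed) :
    P.IsRational K := by
  let F := LeavittPathAlgebra.quotientFamily K E P
  by_cases hF : F.IsLeavitt
  · rcases hF.hasAperiodicPaths_or with h | h
    · exact F.extendedCentroid_isAlgebraic hF h
    · obtain ⟨B, _, _, _, _, ⟨j⟩⟩ := hF.hasCommCorner_of_isolatedCycle h
      exact P.isRational_of_commCorner hP j
  · obtain ⟨B, _, _, _, _, ⟨j⟩⟩ := F.hasCommCorner_of_not_isLeavitt hF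
    exact P.isRational_of_commCorner hP j
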